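/- Let $q=p^m$ with $p$ an odd prime and $m\in\mathbb{N}$ such that $3\mid \frac{q-1}{p-1}$ and $q\ge 5$, and put $n=\frac{q-1}{3}$. Let $R_3=\{x^3 : x\in\mathbb{F}_q^*\}$. Let $\Gamma(3,q)$ be the Cayley graph with vertex set $\mathbb{F}_q$ in which $v,w$ are joined iff $w-v\in R_3$, and let $\Gamma^+(3,q)$ be the Cayley sum graph with vertex set $\mathbb{F}_q$ in which $v,w$ are joined iff $v+w\in R_3$ (so $v$ carries a loop iff $2v\in R_3$; a loop contributes $1$ to the diagonal of the adjacency matrix). Write $Spec=\{[\lambda_1]^{e_1},\dots,[\lambda_s]^{e_s}\}$ when $\lambda_1,\dots,\lambda_s$ are the pairwise different eigenvalues of the adjacency matrix and $e_i\geq 1$ is the multiplicity of $\lambda_i$; here $[\pm\lambda]^e$ stands for the two entries $[\lambda]^e,[-\lambda]^e$. Then $\Gamma^+(3,q)$ is connected and all its eigenvalues are integers. Its non-principal eigenvalues are $\pm$ the non-principal eigenvalues of $\Gamma(3,q)$, each sign with half the multiplicity; that is, there is a multiset $N$ such that the eigenvalues with multiplicity of $\Gamma(3,q)$ are $n$ together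 with two copies of $N$, and those of $\Gamma^+(3,q)$ are $n$ together with $N$ and $-N$. Explicitly: (a) If $p\equiv 1\pmod 3$, then $m=3t$ for some $t\in\mathbb{N}$ (so $\sqrt[3]{q}=p^t$), there are integers $a,b$ with $$4\sqrt[3]{q}=a^2+27b^2,\qquad a\equiv 1\pmod 3,\qquad (a,p)=1,$$ where $a$ is uniquely determined and $b$ is uniquely determined up to sign, and for any such $a,b$ $$Spec(\Gamma^+(3,q))=\Big\{[n]^1,\ \big[\pm\tfrac{a\sqrt[3]{q}-1}{3}\big]^{\frac n2},\ \big[\pm\tfrac{-\frac12(a+9b)\sqrt[3]{q}-1}{3}\big]^{\frac n2},\ \big[\pm\tfrac{-\frac12(a-9b)\sqrt[3]{q}-1}{3}\big]^{\frac n2}\Big\}.$$ (b) If $p\equiv 2\pmod 3$, then $m=2t$ for some $t\in\mathbb{N}$ (so $\sqrt q=p^t$) and $$Spec(\Gamma^+(3,q))=\begin{cases}\big\{[n]^1,\ \big[\pm\tfrac{\sqrt q-1}{3}\big]^{n},\ \big[\pm\tfrac{-2\sqrt q-1}{3}\big]^{\frac n2}\big\} & \text{for } m\equiv 0\pmod 4,\\[2mm]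 \big\{[n]^1,\ \big[\pm\tfrac{2\sqrt q-1}{3}\big]^{\frac n2},\ \big[\pm\tfrac{-\sqrt q-1}{3}\big]^{n}\big\} & \text{for } m\equiv 2\pmod 4.\end{cases}$$ -/

import Mathlib

/-- The set `R_k` of nonzero `k`-th powers of a field `F`. -/
def nonzeroPowers (k : ℕ) (F : Type*) [Field F] : Set F :=
  {y | ∃ x : F, x ≠ 0 ∧ y = x ^ k}

/-- The Cayley graph `X(G, S)`: there is an arrow from `v` to `w` iff `w - v ∈ S`. -/
def cayleyDigraph {G : Type*} [AddCommGroup G] (S : Set G) : Digraph G :=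
  ⟨fun v w => w - v ∈ S⟩

/-- The Cayley sum graph `X⁺(G, S)`: there is an arrow from `v` to `w` iff `v + w ∈ S`
(loops are allowed: `v` carries a loop iff `v + v ∈ S`). -/
def cayleySumDigraph {G : Type*} [AddCommGroup G] (S : Set G) : Digraph G :=
  ⟨fun v w => v + w ∈ S⟩

/-- The generalized Paley graph `Γ(k, q)` over the field `F` with `q` elements. -/
def gpGraph (k : ℕ) (F : Type*) [Field F] : Digraph F :=
  cayleyDigraph (nonzeroPowers k F)

/-- The generalized Paley sum graph `Γ⁺(k, q)` over the field `F` with `q` elements. -/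
def gpSumGraph (k : ℕ) (F : Type*) [Field F] : Digraph F :=
  cayleySumDigraph (nonzeroPowers k F)

/-- A graph with possible loops is connected iff its underlying simple graph is. -/
def Digraph.IsConnected {V : Type*} (Γ : Digraph V) : Prop :=
  Γ.toSimpleGraphInclusive.Connected

open Classical in
/-- The adjacency matrix over `ℂ`; a loop contributes a diagonal entry `1`. -/
noncomputable def Digraph.adjacencyMatrix {V : Type*} (Γ : Digraph V) : Matrix V V ℂ :=
  Matrix.of fun v w => if Γ.Adj v w then 1 else 0

open Classical in
/-- The multiset of all complex eigenvalues of the adjacency matrix, each one repeated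
according to its multiplicity. -/
noncomputable def Digraph.eigenvalues {V : Type*} [Fintype V] (Γ : Digraph V) : Multiset ℂ :=
  Γ.adjacencyMatrix.charpoly.roots

/-- `Spec(Γ) = {[l₁]^{e₁}, …, [l_s]^{e_s}}`: the `l_i` are the pairwise different eigenvalues
of `Γ`, and `e_i > 0` is the multiplicity of `l_i`. -/
def Digraph.HasSpectrum {V : Type*} [Fintype V] (Γ : Digraph V) (l : List (ℂ × ℕ)) : Prop :=
  (l.map Prod.fst).Nodup ∧ (∀ x ∈ l, 0 < x.2) ∧
    Γ.eigenvalues = (l.map fun x => Multiset.replicate x.2 x.1).sum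

/-- The conditions `4 p ^ t = a² + 27 b²`, `a ≡ 1 (mod 3)`, `(a, p) = 1`. -/
def CubicConditions (p t : ℕ) (a b : ℤ) : Prop :=
  4 * (p : ℤ) ^ t = a ^ 2 + 27 * b ^ 2 ∧ a ≡ 1 [ZMOD 3] ∧ IsCoprime a (p : ℤ)

open Finset

/-! For a primitive additive character `ψ`, the functions `w ↦ ψ (w * y)` diagonalise the Cayley
graph, with the cubic periods `η(y) = cubicPeriod ψ y` as eigenvalues. The sum graph sends the
function of `y` to `η(y)` times that of `-y`. Since `-1` is a cube, `η(-y) = η(y)`, so each pair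
`{y, -y}` carries the eigenvalues `±η(y)` (`exists_eigenvalues_eq`).

What remains is to find the three values of `η` on `F*`, or rather `x_i = 3η_i + 1`, the sums of `ψ
(y * x ^ 3)` over `x`. The divisibility hypothesis makes every element of the prime field a cube,
which forces the periods to be integers (`exists_int_cubicPeriod`). Counting zeros of diagonal cubic
forms gives `∑ x_i = 0`, `∑ x_i² = 6q` and `∏ x_i = cq` (`exists_cubicPeriod_values`).

If `p ≡ 2 (mod 3)`, then `p` is inert in the Eisenstein integers, so the `x_i` are `σ, σ, -2σ` with
`σ = ±√q`, the sign being fixed modulo 3. If `p ≡ 1 (mod 3)`, then `p ∤ c`, because the ternary zero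
count is `(2n choose n)` modulo `p` and Lucas applies. Hence `∛q` divides each `x_i`, and the
quotients yield `4∛q = a² + 27b²`. -/

/-! ### Integer arithmetic of `x² + xy + y²` and `a² + 27b²`. -/

theorem Int.dvd_and_dvd_of_dvd_sq_add_mul_add_sq {p : ℕ} (hp : p.Prime) (h3 : p ≡ 2 [MOD 3])
    {x y : ℤ} (h : (p : ℤ) ∣ x ^ 2 + x * y + y ^ 2) : (p : ℤ) ∣ x ∧ (p : ℤ) ∣ y := by
  have := Fact.mk hp
  have hpZ : Prime (p : ℤ) := Nat.prime_iff_prime_int.mp hp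
  have hy : (p : ℤ) ∣ y := by
    rw [← ZMod.intCast_zmod_eq_zero_iff_dvd] at h ⊢
    push_cast at h
    by_contra hy
    -- The ratio is a cube root of unity; since `p - 1 ≡ 1 (mod 3)`, Fermat forces `w = 1`, and then
    -- `3 = 0` in `ZMod p`.
    set w : ZMod p := x / y with hw
    have hxw : (x : ZMod p) = w * y := by rw [hw]; field_simp
    have h1 : w ^ 2 + w + 1 = 0 := by
      have : (y : ZMod p) ^ 2 * (w ^ 2 + w + 1) = 0 := by rw [← h, hxw]; ring
      exact (mul_eq_zero.mp this).resolve_left (pow_ne_zero 2 hy)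
    have h2 : w ^ 3 = 1 := by linear_combination (w - 1) * h1
    have h0 : w ≠ 0 := by rintro h0; simp [h0] at h1
    have h4 : w = 1 := by
      obtain ⟨k, hk⟩ : ∃ k, p - 1 = 3 * k + 1 := ⟨(p - 1) / 3, by
        have := hp.two_le
        unfold Nat.ModEq at h3
        omega⟩
      have := ZMod.pow_card_sub_one_eq_one h0
      rwa [hk, pow_succ, pow_mul, h2, one_pow, one_mul] at this
    have h5 : ((3 : ℕ) : ZMod p) = 0 := by rw [h4] at h1; push_cast; linear_combination h1
    rw [ZMod.natCast_eq_zero_iff, Nat.prime_dvd_prime_iff_eq hp Nat.prime_three] at h5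
    subst h5
    simp [Nat.ModEq] at h3
  refine ⟨?_, hy⟩
  have : (p : ℤ) ∣ x ^ 2 := by
    have h6 : x ^ 2 = (x ^ 2 + x * y + y ^ 2) - y * (x + y) := by ring
    rw [h6]
    exact dvd_sub h (hy.mul_right _)
  exact hpZ.dvd_of_dvd_pow this

theorem Int.exists_eq_pow_mul_of_sq_add_mul_add_sq {p : ℕ} (hp : p.Prime) (h3 : p ≡ 2 [MOD 3])
    (t : ℕ) : ∀ {x y c : ℤ}, x ^ 2 + x * y + y ^ 2 = c * (p : ℤ) ^ (2 * t) →
      ∃ u v : ℤ, x = (p : ℤ) ^ t * u ∧ y = (p : ℤ) ^ t * v ∧ u ^ 2 + u * v + v ^ 2 = c := by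
  induction t with
  | zero => intro x y c h; exact ⟨x, y, by simp, by simp, by simpa using h⟩
  | succ t ih =>
    intro x y c h
    have hp0 : (p : ℤ) ≠ 0 := by exact_mod_cast hp.ne_zero
    obtain ⟨⟨x, rfl⟩, ⟨y, rfl⟩⟩ := Int.dvd_and_dvd_of_dvd_sq_add_mul_add_sq hp h3
      (x := x) (y := y) (h ▸ ⟨c * (p : ℤ) ^ (2 * t + 1), by ring⟩)
    obtain ⟨u, v, rfl, rfl, h4⟩ := ih (x := x) (y := y) (c := c)
      (mul_left_cancel₀ (pow_ne_zero 2 hp0) (by linear_combination h))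
    exact ⟨u, v, by ring, by ring, h4⟩

/-- Together with `-u - v`, each solution is a permutation of `±(1, 1, -2)`. The bounds come from
`(u + 2v)² + 3u² = 12` and its mirror image. -/
theorem Int.sq_add_mul_add_sq_eq_three {u v : ℤ} (h : u ^ 2 + u * v + v ^ 2 = 3) :
    (u = 1 ∧ v = 1) ∨ (u = -1 ∧ v = -1) ∨ (u = 1 ∧ v = -2) ∨ (u = -2 ∧ v = 1) ∨
      (u = -1 ∧ v = 2) ∨ (u = 2 ∧ v = -1) := by
  have h1 : u ≤ 2 := by nlinarith [sq_nonneg (u + 2 * v)]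
  have h2 : -2 ≤ u := by nlinarith [sq_nonneg (u + 2 * v)]
  have h3 : v ≤ 2 := by nlinarith [sq_nonneg (v + 2 * u)]
  have h4 : -2 ≤ v := by nlinarith [sq_nonneg (v + 2 * u)]
  interval_cases u <;> interval_cases v <;> simp_all

/-- The inert case: a triple of integers congruent to `1` modulo `3` with vanishing sum and sum of
squares `6 p ^ (2 t)` is a permutation of `σ, σ, -2σ` with `σ = ± p ^ t`. -/
theorem Int.triple_eq_of_inert {p t : ℕ} (hp : p.Prime) (h3 : p ≡ 2 [MOD 3]) {σ e₀ e₁ e₂ : ℤ}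
    (hσ : σ = (p : ℤ) ^ t ∨ σ = -(p : ℤ) ^ t) (hσ3 : σ ≡ 1 [ZMOD 3])
    (hsum : (3 * e₀ + 1) + (3 * e₁ + 1) + (3 * e₂ + 1) = 0)
    (hsq : (3 * e₀ + 1) ^ 2 + (3 * e₁ + 1) ^ 2 + (3 * e₂ + 1) ^ 2 = 6 * (p : ℤ) ^ (2 * t)) :
    ∃ f g : ℤ, 3 * f + 1 = σ ∧ 3 * g + 1 = -2 * σ ∧
      ({e₀, e₁, e₂} : Multiset ℤ) = {f, f, g} := by
  have h2 : 3 * e₂ + 1 = -(3 * e₀ + 1) - (3 * e₁ + 1) := by linarith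
  obtain ⟨u, v, hu, hv, huv⟩ := Int.exists_eq_pow_mul_of_sq_add_mul_add_sq hp h3 t
    (x := 3 * e₀ + 1) (y := 3 * e₁ + 1) (c := 3) (by rw [h2] at hsq; linarith)
  obtain ⟨k, hk⟩ := hσ3.symm.dvd
  set s := (p : ℤ) ^ t
  have c1 : ({e₀, e₁, e₂} : Multiset ℤ) = {e₀, e₂, e₁} := by
    simp only [Multiset.insert_eq_cons, ← Multiset.singleton_add]; abel
  have c2 : ({e₀, e₁, e₂} : Multiset ℤ) = {e₁, e₂, e₀} := by
    simp only [Multiset.insert_eq_cons, ← Multiset.singleton_add]; abel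
  -- Residues modulo 3 match the sign of the solution with that of `σ`, eliminating half of the
  -- twelve cases.
  rcases Int.sq_add_mul_add_sq_eq_three huv with h | h | h | h | h | h <;>
    obtain ⟨rfl, rfl⟩ := h <;> rcases hσ with hσ | hσ <;> try (exfalso; omega)
  · exact ⟨e₀, e₂, by omega, by omega, by rw [show e₁ = e₀ by omega]⟩
  · exact ⟨e₀, e₂, by omega, by omega, by rw [show e₁ = e₀ by omega]⟩
  · exact ⟨e₀, e₁, by omega, by omega, by rw [c1, show e₂ = e₀ by omega]⟩
  · exact ⟨e₁, e₀, by omega, by omega, by rw [c2, show e₂ = e₁ by omega]⟩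
  · exact ⟨e₀, e₁, by omega, by omega, by rw [c1, show e₂ = e₀ by omega]⟩
  · exact ⟨e₁, e₀, by omega, by omega, by rw [c2, show e₂ = e₁ by omega]⟩

/-- The split case: the roots of `x³ - 3qx - cq`, `q = p ^ (3t)`, `p ∤ c`, when they are integers
congruent to `1` modulo `3`. -/
theorem Int.triple_eq_of_split {p t : ℕ} (hp : p.Prime) (h3 : p ≡ 1 [MOD 3]) (ht : 0 < t)
    {e₀ e₁ e₂ c : ℤ}
    (hsum : (3 * e₀ + 1) + (3 * e₁ + 1) + (3 * e₂ + 1) = 0)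
    (hsq : (3 * e₀ + 1) ^ 2 + (3 * e₁ + 1) ^ 2 + (3 * e₂ + 1) ^ 2 = 6 * (p : ℤ) ^ (3 * t))
    (hprod : (3 * e₀ + 1) * (3 * e₁ + 1) * (3 * e₂ + 1) = (p : ℤ) ^ (3 * t) * c)
    (hc : ¬ (p : ℤ) ∣ c) :
    ∃ a b f g h : ℤ, CubicConditions p t a b ∧ 3 * f + 1 = a * (p : ℤ) ^ t ∧
      2 * (3 * g + 1) = -(a + 9 * b) * (p : ℤ) ^ t ∧
      2 * (3 * h + 1) = -(a - 9 * b) * (p : ℤ) ^ t ∧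
      ({e₀, e₁, e₂} : Multiset ℤ) = {f, g, h} := by
  have hpZ : Prime (p : ℤ) := Nat.prime_iff_prime_int.mp hp
  set s := (p : ℤ) ^ t with hs
  have hs0 : s ≠ 0 := pow_ne_zero _ hpZ.ne_zero
  have hps : (p : ℤ) ∣ s := dvd_pow_self _ ht.ne'
  have hq : (p : ℤ) ^ (3 * t) = s ^ 3 := by rw [hs, ← pow_mul, mul_comm]
  rw [hq] at hsq hprod
  have hs3 : s ≡ 1 [ZMOD 3] := by
    have : (p : ℤ) ≡ 1 [ZMOD 3] := by exact_mod_cast (Int.natCast_modEq_iff.mpr h3)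
    simpa using this.pow t
  have key : ∀ x y z : ℤ, x + y + z = 0 → x ^ 2 + y ^ 2 + z ^ 2 = 6 * s ^ 3 →
      x * y * z = s ^ 3 * c → x ≡ 1 [ZMOD 3] →
      ∃ f : ℤ, x = s * (3 * f + 1) ∧ ¬ (p : ℤ) ∣ (3 * f + 1) := by
    intro x y z h1 h2 h4 h5
    have hz : z = -x - y := by linarith
    subst hz
    have h6 : x ^ 2 + x * y + y ^ 2 = 3 * s ^ 3 := by linarith
    -- `x` is a root of `X³ - 3s³X - cs³`, so `s³ ∣ x³` and therefore `s ∣ x`.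
    have hx : x ^ 3 = s ^ 3 * (3 * x + c) := by linear_combination h4 + x * h6
    obtain ⟨w, rfl⟩ : s ∣ x := (Int.pow_dvd_pow_iff three_ne_zero).mp ⟨_, hx⟩
    have hw : w ^ 3 = 3 * (s * w) + c :=
      mul_left_cancel₀ (pow_ne_zero 3 hs0) (by linear_combination hx)
    have hw3 : w ≡ 1 [ZMOD 3] := by
      have := (hs3.mul_right w).symm.trans h5
      simpa using this
    obtain ⟨f, hf⟩ := hw3.symm.dvd
    refine ⟨f, by rw [← hf]; ring, fun hd => hc ?_⟩
    rw [← hf] at hd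
    have hd' : (p : ℤ) ∣ w := by simpa using hd
    have : c = w ^ 3 - 3 * (s * w) := by linarith
    rw [this]
    exact dvd_sub (dvd_pow hd' three_ne_zero) ((hps.mul_right _).mul_left _)
  have m1 : ∀ e : ℤ, 3 * e + 1 ≡ 1 [ZMOD 3] := fun e => by simp [Int.ModEq]
  obtain ⟨f₀, h0, n0⟩ := key _ _ _ hsum hsq hprod (m1 e₀)
  obtain ⟨f₁, h1, n1⟩ := key (3 * e₁ + 1) (3 * e₀ + 1) (3 * e₂ + 1) (by linarith) (by linarith)
    (by linarith) (m1 e₁)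
  obtain ⟨f₂, h2, n2⟩ := key (3 * e₂ + 1) (3 * e₀ + 1) (3 * e₁ + 1) (by linarith) (by linarith)
    (by linarith) (m1 e₂)
  have fin : ∀ d₀ d₁ d₂ k₀ k₁ k₂ : ℤ, 3 * d₀ + 1 = s * (3 * k₀ + 1) →
      3 * d₁ + 1 = s * (3 * k₁ + 1) → 3 * d₂ + 1 = s * (3 * k₂ + 1) →
      (3 * d₀ + 1) + (3 * d₁ + 1) + (3 * d₂ + 1) = 0 →
      (3 * d₀ + 1) ^ 2 + (3 * d₁ + 1) ^ 2 + (3 * d₂ + 1) ^ 2 = 6 * s ^ 3 →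
      ¬ (p : ℤ) ∣ (3 * k₀ + 1) → k₁ ≡ k₂ [ZMOD 3] →
      ∃ a b f g h : ℤ, CubicConditions p t a b ∧ 3 * f + 1 = a * s ∧
        2 * (3 * g + 1) = -(a + 9 * b) * s ∧ 2 * (3 * h + 1) = -(a - 9 * b) * s ∧
        ({d₀, d₁, d₂} : Multiset ℤ) = {f, g, h} := by
    intro d₀ d₁ d₂ k₀ k₁ k₂ g0 g1 g2 gs gq gn gk
    -- The quotients `3k₁ + 1` and `3k₂ + 1` agree modulo 9, and `b` is a ninth of their difference;
    -- `a` will be the third quotient.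
    obtain ⟨b, hb⟩ := gk.dvd
    have gs' : (3 * k₀ + 1) + (3 * k₁ + 1) + (3 * k₂ + 1) = 0 :=
      mul_left_cancel₀ hs0 (by linear_combination gs - g0 - g1 - g2)
    have gq' : (3 * k₀ + 1) ^ 2 + (3 * k₁ + 1) ^ 2 + (3 * k₂ + 1) ^ 2 = 6 * s := by
      rw [g0, g1, g2] at gq
      exact mul_left_cancel₀ (pow_ne_zero 2 hs0) (by linear_combination gq)
    have e2 : 2 * (3 * k₂ + 1) = -(3 * k₀ + 1) + 9 * b := by linarith
    have e1 : 2 * (3 * k₁ + 1) = -(3 * k₀ + 1) - 9 * b := by linarith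
    refine ⟨3 * k₀ + 1, b, d₀, d₁, d₂, ⟨?_, m1 _, ?_⟩, by rw [g0]; ring, ?_, ?_, rfl⟩
    · have : (2 * (3 * k₁ + 1)) ^ 2 + (2 * (3 * k₂ + 1)) ^ 2
          = 4 * (6 * s - (3 * k₀ + 1) ^ 2) := by linarith
      rw [e1, e2] at this
      linarith
    · exact ((Prime.coprime_iff_not_dvd hpZ).mpr gn).symm
    · rw [g1]; linear_combination s * e1
    · rw [g2]; linear_combination s * e2
  have c1 : ({e₀, e₁, e₂} : Multiset ℤ) = {e₂, e₀, e₁} := by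
    simp only [Multiset.insert_eq_cons, ← Multiset.singleton_add]; abel
  have c2 : ({e₀, e₁, e₂} : Multiset ℤ) = {e₁, e₀, e₂} := by
    simp only [Multiset.insert_eq_cons, ← Multiset.singleton_add]; abel
  have gs' : (3 * f₀ + 1) + (3 * f₁ + 1) + (3 * f₂ + 1) = 0 :=
    mul_left_cancel₀ hs0 (by linear_combination hsum - h0 - h1 - h2)
  -- The `f_i` sum to `-1`, whereas three distinct residues modulo 3 would sum to `0`.
  have : f₀ ≡ f₁ [ZMOD 3] ∨ f₀ ≡ f₂ [ZMOD 3] ∨ f₁ ≡ f₂ [ZMOD 3] := by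
    unfold Int.ModEq; omega
  rcases this with h | h | h
  · rw [c1]; exact fin _ _ _ _ _ _ h2 h0 h1 (by linarith) (by linarith) n2 h
  · rw [c2]; exact fin _ _ _ _ _ _ h1 h0 h2 (by linarith) (by linarith) n1 h
  · exact fin _ _ _ _ _ _ h0 h1 h2 hsum hsq n0 h

theorem CubicConditions.not_dvd {p t : ℕ} {a b : ℤ} (hp : p.Prime) (h : CubicConditions p t a b) :
    ¬ (p : ℤ) ∣ a :=
  (Prime.coprime_iff_not_dvd (Nat.prime_iff_prime_int.mp hp)).mp h.2.2.symm

theorem CubicConditions.neg {p t : ℕ} {a b : ℤ} (h : CubicConditions p t a b) :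
    CubicConditions p t a (-b) :=
  ⟨by rw [h.1]; ring, h.2⟩

/-- The product `(ab' - a'b)(ab' + a'b)` is divisible by `p ^ t`, and `p` cannot divide both
factors, so `p ^ t` divides one of them. Composition of the norm forms then leaves room only for
that factor to vanish. -/
theorem CubicConditions.unique {p t : ℕ} (hp : p.Prime) (hodd : p ≠ 2) (ht : 0 < t)
    {a b a' b' : ℤ} (h : CubicConditions p t a b) (h' : CubicConditions p t a' b') :
    a = a' ∧ (b = b' ∨ b = -b') := by
  have hpZ : Prime (p : ℤ) := Nat.prime_iff_prime_int.mp hp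
  have hs0 : 0 < (p : ℤ) ^ t := pow_pos (by exact_mod_cast hp.pos) _
  have hps : (p : ℤ) ∣ (p : ℤ) ^ t := dvd_pow_self _ ht.ne'
  have main : ∀ a b a' b' : ℤ, CubicConditions p t a b → CubicConditions p t a' b' →
      (p : ℤ) ^ t ∣ a * b' - a' * b → a = a' ∧ (b = b' ∨ b = -b') := by
    rintro a b a' b' ⟨h1, h2, h4⟩ ⟨h1', h2', h4'⟩ ⟨k, hk⟩
    set s := (p : ℤ) ^ t
    -- Multiplicativity of the norm `a² + 27b²`. With `ab' - a'b = sk` it gives `27k² ≤ 16`, so `k =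
    -- 0`.
    have e1 : (a * a' + 27 * b * b') ^ 2 + 27 * (a * b' - a' * b) ^ 2 = 16 * s ^ 2 := by
      linear_combination (-4 * s) * h1 - (a ^ 2 + 27 * b ^ 2) * h1'
    have hk0 : k = 0 := by
      rw [hk] at e1
      have : 27 * k ^ 2 ≤ 16 := by
        have : s ^ 2 * (27 * k ^ 2) ≤ s ^ 2 * 16 := by
          nlinarith [sq_nonneg (a * a' + 27 * b * b')]
        exact le_of_mul_le_mul_left this (by positivity)
      by_contra hne
      have : 0 < k ^ 2 := by positivity
      linarith
    rw [hk0, mul_zero] at hk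
    have e2 : 4 * s * (b' ^ 2 - b ^ 2) = 0 := by
      linear_combination (a * b' + a' * b) * hk + b' ^ 2 * h1 - b ^ 2 * h1'
    have e3 : b ^ 2 = b' ^ 2 := by
      have := (mul_eq_zero.mp e2).resolve_left (by positivity)
      linarith
    have e4 : a ^ 2 = a' ^ 2 := by linarith
    refine ⟨?_, sq_eq_sq_iff_eq_or_eq_neg.mp e3⟩
    rcases sq_eq_sq_iff_eq_or_eq_neg.mp e4 with e | e
    · exact e
    · unfold Int.ModEq at h2 h2'; omega
  have e : (a * b' - a' * b) * (a * b' + a' * b) = (p : ℤ) ^ t * (4 * (b' ^ 2 - b ^ 2)) := by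
    linear_combination -b' ^ 2 * h.1 + b ^ 2 * h'.1
  by_cases hd : (p : ℤ) ∣ a * b' + a' * b
  · by_cases hd2 : (p : ℤ) ∣ a * b' - a' * b
    · exfalso
      have h2 : (p : ℤ) ∣ 2 * (a * b') := by
        have := dvd_add hd hd2
        rwa [show a * b' + a' * b + (a * b' - a' * b) = 2 * (a * b') by ring] at this
      have hp2 : ¬ (p : ℤ) ∣ 2 := fun h => hodd
        ((Nat.prime_dvd_prime_iff_eq hp Nat.prime_two).mp (by exact_mod_cast h))
      have hb' := ((hpZ.dvd_or_dvd ((hpZ.dvd_or_dvd h2).resolve_left hp2))).resolve_left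
        (h.not_dvd hp)
      apply h'.not_dvd hp
      apply hpZ.dvd_of_dvd_pow (n := 2)
      have : a' ^ 2 = 4 * (p : ℤ) ^ t - 27 * b' ^ 2 := by linarith [h'.1]
      rw [this]
      exact dvd_sub (hps.mul_left _) ((dvd_pow hb' two_ne_zero).mul_left _)
    · have hcop : IsCoprime ((p : ℤ) ^ t) (a * b' - a' * b) :=
        ((Prime.coprime_iff_not_dvd hpZ).mpr hd2).pow_left
      have := main a b a' (-b') h h'.neg (by
        have := hcop.dvd_of_dvd_mul_left ⟨_, e⟩
        rw [show a * -b' - a' * b = -(a * b' + a' * b) by ring]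
        exact (dvd_neg).mpr this)
      simpa [or_comm] using this
  · have hcop : IsCoprime ((p : ℤ) ^ t) (a * b' + a' * b) :=
      ((Prime.coprime_iff_not_dvd hpZ).mpr hd).pow_left
    exact main a b a' b' h h' (hcop.dvd_of_dvd_mul_right ⟨_, e⟩)

/-! ### Binomial coefficients modulo `p`, and enumeration by a generator. -/

/-- The binomial coefficients `((i + j)n choose in)`, `n = k (1 + p + ⋯ + p ^ (m - 1))`, are prime
to `p` as long as no carries occur. -/
theorem Nat.not_dvd_choose_geom {p k i j : ℕ} (hp : p.Prime) (hk : (i + j) * k < p) (m : ℕ) :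
    ¬ p ∣ Nat.choose ((i + j) * (k * ∑ l ∈ Finset.range m, p ^ l))
      (i * (k * ∑ l ∈ Finset.range m, p ^ l)) := by
  have := Fact.mk hp
  induction m with
  | zero => simpa using hp.one_lt.ne'
  | succ m ih =>
    have hi : i * k < p := by nlinarith
    -- Splits off the lowest base-`p` digit `c * k`, so that Lucas reduces length `m + 1` to length
    -- `m`.
    have key : ∀ c : ℕ, c * (k * ∑ l ∈ Finset.range (m + 1), p ^ l) =
        c * k + p * (c * (k * ∑ l ∈ Finset.range m, p ^ l)) := by
      intro c
      rw [Finset.sum_range_succ']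
      simp_rw [pow_succ, ← Finset.sum_mul]
      ring
    have := @Choose.choose_modEq_choose_mod_mul_choose_div_nat
      ((i + j) * (k * ∑ l ∈ Finset.range (m + 1), p ^ l))
      (i * (k * ∑ l ∈ Finset.range (m + 1), p ^ l)) p _
    rw [this.dvd_iff dvd_rfl, key, key, Nat.add_mul_mod_self_left, Nat.add_mul_mod_self_left,
      Nat.add_mul_div_left _ _ hp.pos, Nat.add_mul_div_left _ _ hp.pos, Nat.mod_eq_of_lt hk,
      Nat.mod_eq_of_lt hi, Nat.div_eq_of_lt hk, Nat.div_eq_of_lt hi, zero_add, zero_add,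
      hp.dvd_mul]
    rintro (h | h)
    · exact hp.coprime_iff_not_dvd.mp
        (hp.coprime_choose_of_lt hk (Nat.mul_le_mul_right k (Nat.le_add_right i j))) h
    · exact ih h

/-- In a finite field with `3n + 1` elements, the powers `g ^ i`, `i < 3n`, of a suitable `g`
list the nonzero elements. -/
theorem FiniteField.exists_generator {F : Type*} [Field F] [Fintype F] [DecidableEq F] {N : ℕ}
    (hN : Fintype.card F = N + 1) :
    ∃ g : F, g ≠ 0 ∧ orderOf g = N ∧
      (univ.erase (0 : F)).val = (Multiset.range N).map (fun i => g ^ i) := by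
  obtain ⟨u, hu⟩ := IsCyclic.exists_generator (α := Fˣ)
  have ho : orderOf (u : F) = N := by
    rw [orderOf_units, orderOf_eq_card_of_forall_mem_zpowers hu, Nat.card_eq_fintype_card,
      Fintype.card_units, hN, Nat.add_sub_cancel]
  refine ⟨u, u.ne_zero, ho, ?_⟩
  have hinj : Set.InjOn (fun i => (u : F) ^ i) (range N) := by
    rw [← ho, coe_range]
    exact pow_injOn_Iio_orderOf
  have himg : (range N).image (fun i => (u : F) ^ i) = univ.erase 0 := by
    apply eq_of_subset_of_card_le
    · intro x hx
      obtain ⟨i, -, rfl⟩ := mem_image.mp hx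
      simp
    · rw [card_erase_of_mem (mem_univ _), card_univ, hN, card_image_of_injOn hinj, card_range,
        Nat.add_sub_cancel]
  rw [← himg, image_val_of_injOn hinj, range_val]

theorem Multiset.map_range_three_mul_of_periodic {α : Type*} {f : ℕ → α}
    (hf : ∀ i, f (i + 3) = f i) (n : ℕ) :
    (Multiset.range (3 * n)).map f = n • {f 0, f 1, f 2} := by
  have key : ∀ n, f (3 * n) = f 0 ∧ f (3 * n + 1) = f 1 ∧ f (3 * n + 2) = f 2 := by
    intro n
    induction n with
    | zero => simp
    | succ n ih =>
      rw [show 3 * (n + 1) = 3 * n + 3 by ring, hf, show 3 * n + 3 + 1 = 3 * n + 1 + 3 by ring, hf,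
        show 3 * n + 3 + 2 = 3 * n + 2 + 3 by ring, hf]
      exact ih
  induction n with
  | zero => simp
  | succ n ih =>
    rw [show 3 * (n + 1) = 3 * n + 1 + 1 + 1 by ring, Multiset.range_succ, Multiset.range_succ,
      Multiset.range_succ]
    rw [Multiset.map_cons, Multiset.map_cons, Multiset.map_cons, ih, (key n).1, (key n).2.1,
      show 3 * n + 1 + 1 = 3 * n + 2 by ring, (key n).2.2, succ_nsmul]
    simp only [Multiset.insert_eq_cons, ← Multiset.singleton_add]
    abel

/-! ### Cubes in a field with `3n + 1` elements. -/

section Cubes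

variable {F : Type*} [Field F] [Fintype F] {n : ℕ}

/-- Functions constant on cosets of the cubes. -/
theorem FiniteField.exists_map_erase_zero [DecidableEq F] (hn : Fintype.card F = 3 * n + 1) :
    ∃ g : F, g ≠ 0 ∧ ∀ {α : Type} (f : F → α), (∀ x z : F, z ≠ 0 → f (x * z ^ 3) = f x) →
      (univ.erase (0 : F)).val.map f = n • {f 1, f g, f (g ^ 2)} := by
  obtain ⟨g, hg, -, hval⟩ := FiniteField.exists_generator hn
  refine ⟨g, hg, fun f hf => ?_⟩
  have := Multiset.map_range_three_mul_of_periodic (f := fun i => f (g ^ i))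
    (fun i => by simp only [pow_add, hf _ _ hg]) n
  rw [hval, Multiset.map_map]
  simpa using this

theorem FiniteField.exists_cube_of_pow_eq_one (hn : Fintype.card F = 3 * n + 1) {c : F}
    (hc : c ^ n = 1) : ∃ z : F, z ≠ 0 ∧ c = z ^ 3 := by
  classical
  have hn0 : n ≠ 0 := by
    rintro rfl
    have := Fintype.one_lt_card (α := F)
    omega
  obtain ⟨g, hg, ho, hval⟩ := FiniteField.exists_generator hn
  have hc0 : c ≠ 0 := by rintro rfl; simp [hn0] at hc
  have : c ∈ (univ.erase (0 : F)).val := mem_val.mpr (mem_erase.mpr ⟨hc0, mem_univ _⟩)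
  rw [hval] at this
  obtain ⟨i, -, rfl⟩ := Multiset.mem_map.mp this
  have h1 : 3 * n ∣ i * n := by
    rw [← ho]
    exact orderOf_dvd_of_pow_eq_one (by rwa [pow_mul])
  obtain ⟨j, rfl⟩ := Nat.dvd_of_mul_dvd_mul_right (Nat.pos_of_ne_zero hn0) h1
  exact ⟨g ^ j, pow_ne_zero _ hg, by rw [← pow_mul, mul_comm]⟩

theorem FiniteField.exists_sq_add_add_one (hn : Fintype.card F = 3 * n + 1) :
    ∃ w : F, w ^ 2 + w + 1 = 0 := by
  classical
  have hn0 : n ≠ 0 := by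
    rintro rfl
    have := Fintype.one_lt_card (α := F)
    omega
  obtain ⟨g, hg, ho, -⟩ := FiniteField.exists_generator hn
  refine ⟨g ^ n, ?_⟩
  have h1 : g ^ n ≠ 1 := by
    intro h
    have := Nat.le_of_dvd (Nat.pos_of_ne_zero hn0) (ho ▸ orderOf_dvd_of_pow_eq_one h)
    omega
  have h3 : (g ^ n) ^ 3 = 1 := by rw [← pow_mul, mul_comm, ← ho, pow_orderOf_eq_one]
  exact (mul_eq_zero.mp (show (g ^ n - 1) * ((g ^ n) ^ 2 + g ^ n + 1) = 0 by
    linear_combination h3)).resolve_left (sub_ne_zero.mpr h1)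

theorem FiniteField.three_ne_zero (hn : Fintype.card F = 3 * n + 1) : (3 : F) ≠ 0 := by
  have h := Nat.cast_card_eq_zero F
  rw [hn] at h
  push_cast at h
  rintro h3
  simp [h3] at h

theorem FiniteField.card_cube_roots [DecidableEq F] (hn : Fintype.card F = 3 * n + 1) {a : F}
    (ha : a ≠ 0) : #{x : F | x ^ 3 = a ^ 3} = 3 := by
  obtain ⟨w, hw⟩ := FiniteField.exists_sq_add_add_one hn
  have h3 := FiniteField.three_ne_zero hn
  have hw1 : w ≠ 1 := by
    rintro rfl
    exact h3 (by linear_combination hw)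
  have hw0 : w ≠ 0 := by rintro rfl; simp at hw
  have hset : ({x : F | x ^ 3 = a ^ 3} : Finset F) = {a, w * a, w ^ 2 * a} := by
    ext x
    simp only [mem_filter, mem_univ, true_and, mem_insert, mem_singleton]
    have : x ^ 3 - a ^ 3 = (x - a) * ((x - w * a) * (x - w ^ 2 * a)) := by
      linear_combination (x - a) * (a * x - a ^ 2 * (w - 1)) * hw
    rw [← sub_eq_zero, this, mul_eq_zero, mul_eq_zero, sub_eq_zero, sub_eq_zero, sub_eq_zero]
  rw [hset, card_insert_of_notMem, card_pair]
  · intro h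
    have h1 := mul_right_cancel₀ ha h
    exact hw1 (mul_left_cancel₀ hw0 (by linear_combination -h1))
  · simp only [mem_insert, mem_singleton, not_or]
    constructor
    · intro h
      exact hw1 (mul_right_cancel₀ ha (by linear_combination -h))
    · intro h
      have h1 : w ^ 2 = 1 := mul_right_cancel₀ ha (by linear_combination -h)
      have h2 : w = -2 := by linear_combination hw - h1
      rw [h2] at h1
      exact h3 (by linear_combination h1)

/-- Cubing is three-to-one on `F*` and fixes `0`. -/
theorem FiniteField.sum_comp_cube [DecidableEq F] [DecidablePred (· ∈ nonzeroPowers 3 F)]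
    (hn : Fintype.card F = 3 * n + 1) {A : Type*} [AddCommMonoid A] (f : F → A) :
    ∑ x : F, f (x ^ 3) = f 0 + 3 • ∑ x : F with x ∈ nonzeroPowers 3 F, f x := by
  have himg : (univ.erase (0 : F)).image (fun x => x ^ 3) =
      ({x : F | x ∈ nonzeroPowers 3 F} : Finset F) := by
    ext y
    simp only [mem_image, mem_erase, mem_filter, mem_univ, and_true, true_and]
    exact ⟨fun ⟨a, ha, h⟩ => ⟨a, ha, h.symm⟩, fun ⟨a, ha, h⟩ => ⟨a, ha, h.symm⟩⟩
  rw [← add_sum_erase univ _ (mem_univ (0 : F)), sum_comp f (fun x : F => x ^ 3), himg, smul_sum]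
  congr 1
  · simp
  · refine sum_congr rfl fun y hy => ?_
    obtain ⟨a, ha, rfl⟩ := (mem_filter.mp hy).2
    congr 1
    refine (congrArg Finset.card ?_).trans (FiniteField.card_cube_roots hn ha)
    ext x
    simp only [mem_filter, mem_erase, mem_univ, and_true, true_and, and_iff_right_iff_imp]
    rintro h rfl
    exact ha (by simpa using h.symm)

theorem FiniteField.card_nonzero_cubes [DecidablePred (· ∈ nonzeroPowers 3 F)]
    (hn : Fintype.card F = 3 * n + 1) :
    #{x : F | x ∈ nonzeroPowers 3 F} = n := by
  classical
  have := FiniteField.sum_comp_cube hn (fun _ : F => 1)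
  simp only [sum_const, card_univ, hn, smul_eq_mul, mul_one] at this
  omega

theorem neg_mem_nonzeroPowers_three {F : Type*} [Field F] {x : F} (hx : x ∈ nonzeroPowers 3 F) :
    -x ∈ nonzeroPowers 3 F := by
  obtain ⟨z, hz, rfl⟩ := hx
  exact ⟨-z, neg_ne_zero.mpr hz, by ring⟩

/-! ### Counting zeros of diagonal cubic forms -/

/-- As `-x³ = (-x)³`, each of the `3n` nonzero `x` admits three `y`, and `x = 0` admits one. -/
theorem FiniteField.card_binary_cubic_zeros [DecidableEq F] (hn : Fintype.card F = 3 * n + 1) :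
    #{v : F × F | v.1 ^ 3 + v.2 ^ 3 = 0} = 9 * n + 1 := by
  rw [← univ_product_univ, card_filter, sum_product]
  simp_rw [← card_filter]
  rw [← add_sum_erase univ _ (mem_univ (0 : F)), sum_congr rfl (g := fun _ => 3)]
  · have : ({y : F | (0 : F) ^ 3 + y ^ 3 = 0} : Finset F) = {0} := by ext; simp
    rw [this, card_singleton, sum_const, card_erase_of_mem (mem_univ _), card_univ, hn]
    simp only [smul_eq_mul]
    omega
  · intro x hx
    refine (congrArg Finset.card ?_).trans
      (FiniteField.card_cube_roots hn (neg_ne_zero.mpr (ne_of_mem_erase hx)))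
    ext y
    simp only [mem_filter, mem_univ, true_and]
    constructor <;> intro h <;> linear_combination h

theorem FiniteField.sum_pow_three_mul (hn : Fintype.card F = 3 * n + 1) (j : ℕ) :
    ∑ x : F, (x ^ 3) ^ j = if n ∣ j ∧ j ≠ 0 then -1 else 0 := by
  classical
  by_cases hj : j = 0
  -- With `0 ^ 0 = 1` the sum is `q`, which vanishes in `F`; hence the clause `j ≠ 0`.
  · simp [hj]
  have h := FiniteField.sum_pow_units F (3 * j)
  simp only [hn, Nat.add_sub_cancel, Nat.mul_dvd_mul_iff_left (show 0 < 3 by norm_num)] at h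
  simp only [hj, ne_eq, not_false_eq_true, and_true]
  rw [← h, ← Fintype.sum_subtype_add_sum_subtype (fun x : F => x ≠ 0)]
  have h0 : ∑ x : {x : F // ¬ x ≠ 0}, ((x : F) ^ 3) ^ j = 0 :=
    sum_eq_zero fun x _ => by
      have : (x : F) = 0 := not_not.mp x.2
      simp [this, hj]
  rw [h0, add_zero, ← unitsEquivNeZero.sum_comp]
  exact sum_congr rfl fun x _ => by simp [pow_mul]

theorem FiniteField.sum_sum_cube_add_cube_pow (hn : Fintype.card F = 3 * n + 1) (N : ℕ) :
    ∑ x : F, ∑ y : F, (x ^ 3 + y ^ 3) ^ N =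
      ∑ i ∈ range (N + 1), (if n ∣ i ∧ i ≠ 0 then -1 else 0) *
        (if n ∣ N - i ∧ N - i ≠ 0 then -1 else 0) * (N.choose i : F) := by
  simp_rw [add_pow]
  have : ∀ x : F, ∑ y : F, ∑ i ∈ range (N + 1), (x ^ 3) ^ i * (y ^ 3) ^ (N - i) * (N.choose i : F)
      = ∑ i ∈ range (N + 1), (x ^ 3) ^ i *
        (if n ∣ N - i ∧ N - i ≠ 0 then -1 else 0) * (N.choose i : F) := by
    intro x
    rw [sum_comm]
    refine sum_congr rfl fun i _ => ?_
    rw [← FiniteField.sum_pow_three_mul hn, mul_sum, sum_mul]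
  simp_rw [this]
  rw [sum_comm]
  refine sum_congr rfl fun i _ => ?_
  rw [← FiniteField.sum_pow_three_mul hn i, sum_mul, sum_mul]

/-- For `v ≠ 0`, `v ^ n` is a cube root of unity, equal to `1` exactly on cubes; the right side is
then `3` or `0`, and it is `1` at `v = 0`. -/
theorem FiniteField.cast_card_cube_eq [DecidableEq F] (hn : Fintype.card F = 3 * n + 1) (v : F) :
    (#{z : F | z ^ 3 = v} : F) = 1 + v ^ n + v ^ (2 * n) := by
  have hn0 : n ≠ 0 := by
    rintro rfl
    have := Fintype.one_lt_card (α := F)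
    omega
  by_cases hv : v = 0
  · subst hv
    have : ({z : F | z ^ 3 = 0} : Finset F) = {0} := by ext; simp
    rw [this]
    simp [hn0]
  by_cases h1 : v ^ n = 1
  · obtain ⟨a, ha, rfl⟩ := FiniteField.exists_cube_of_pow_eq_one hn h1
    rw [FiniteField.card_cube_roots hn ha, mul_comm, pow_mul, h1]
    norm_num
  · have h3 : (v ^ n) ^ 3 = 1 := by
      rw [← pow_mul, mul_comm]
      have := FiniteField.pow_card_sub_one_eq_one v hv
      rwa [hn, Nat.add_sub_cancel] at this
    have he : ({z : F | z ^ 3 = v} : Finset F) = ∅ := by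
      rw [filter_eq_empty_iff]
      rintro z - rfl
      apply h1
      rw [← pow_mul]
      have := FiniteField.pow_card_sub_one_eq_one z (by rintro rfl; simp at hv)
      rwa [hn, Nat.add_sub_cancel] at this
    rw [he, card_empty, Nat.cast_zero, mul_comm 2 n, pow_mul]
    refine (mul_left_cancel₀ (sub_ne_zero.mpr h1) ?_).symm
    linear_combination h3

/-- Sum `1 + v ^ n + v ^ (2 * n)` over `v = -(x³ + y³)`. The constant gives `q² = 0`. In the
binomial expansions only terms with both exponents positive multiples of `n` survive: none in degree
`n`, the middle one in degree `2n`. -/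
theorem FiniteField.cast_card_ternary_cubic_zeros [DecidableEq F]
    (hn : Fintype.card F = 3 * n + 1) (heven : Even n) :
    (#{v : F × F × F | v.1 ^ 3 + v.2.1 ^ 3 + v.2.2 ^ 3 = 0} : F) = (2 * n).choose n := by
  have hn0 : n ≠ 0 := by
    rintro rfl
    have := Fintype.one_lt_card (α := F)
    omega
  have hq : (Fintype.card F : F) = 0 := Nat.cast_card_eq_zero F
  have h1 : #{v : F × F × F | v.1 ^ 3 + v.2.1 ^ 3 + v.2.2 ^ 3 = 0} =
      ∑ x : F, ∑ y : F, #{z : F | z ^ 3 = -(x ^ 3 + y ^ 3)} := by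
    rw [← univ_product_univ, card_filter, sum_product]
    refine sum_congr rfl fun x _ => ?_
    rw [← univ_product_univ, sum_product]
    refine sum_congr rfl fun y _ => ?_
    rw [card_filter]
    refine sum_congr rfl fun z _ => ?_
    simp only [eq_neg_iff_add_eq_zero, add_comm]
  rw [h1]
  push_cast
  simp_rw [FiniteField.cast_card_cube_eq hn, heven.neg_pow, (even_two_mul n).neg_pow,
    sum_add_distrib]
  have h2 : ∑ x : F, ∑ y : F, (x ^ 3 + y ^ 3) ^ n = 0 := by
    rw [FiniteField.sum_sum_cube_add_cube_pow hn]
    refine sum_eq_zero fun i hi => ?_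
    by_cases h : n ∣ i ∧ i ≠ 0
    · have h' : ¬ (n ∣ n - i ∧ n - i ≠ 0) := by
        rintro ⟨-, h'⟩
        have := Nat.le_of_dvd (Nat.pos_of_ne_zero h.2) h.1
        omega
      rw [if_neg h']
      ring
    · rw [if_neg h]
      ring
  have h3 : ∑ x : F, ∑ y : F, (x ^ 3 + y ^ 3) ^ (2 * n) = (2 * n).choose n := by
    rw [FiniteField.sum_sum_cube_add_cube_pow hn, sum_eq_single n]
    · rw [if_pos ⟨dvd_rfl, hn0⟩, show 2 * n - n = n by omega, if_pos ⟨dvd_rfl, hn0⟩]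
      ring
    · intro i hi hin
      by_cases h : n ∣ i ∧ i ≠ 0
      · have h' : ¬ (n ∣ 2 * n - i ∧ 2 * n - i ≠ 0) := by
          rintro h'
          have := Nat.le_of_dvd (Nat.pos_of_ne_zero h.2) h.1
          have := Nat.le_of_dvd (Nat.pos_of_ne_zero h'.2) h'.1
          omega
        rw [if_neg h']
        ring
      · rw [if_neg h]
        ring
    · intro h
      exact absurd (mem_range.mpr (by omega)) h
  rw [h2, h3]
  simp [hq]

end Cubes

/-! ### Cubic Gaussian periods: integrality and moments. -/

section Periods

variable {F : Type*} [Field F] [Fintype F] {n : ℕ}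

open Classical in
/-- The cubic Gaussian periods. -/
noncomputable def cubicPeriod (ψ : AddChar F ℂ) (y : F) : ℂ :=
  ∑ x : F with x ∈ nonzeroPowers 3 F, ψ (y * x)

theorem cubicPeriod_zero (hn : Fintype.card F = 3 * n + 1) (ψ : AddChar F ℂ) :
    cubicPeriod ψ 0 = n := by
  classical
  simp only [cubicPeriod, zero_mul, AddChar.map_zero_eq_one, sum_const, nsmul_eq_mul, mul_one]
  rw [FiniteField.card_nonzero_cubes hn]

theorem sum_addChar_mul_cube (hn : Fintype.card F = 3 * n + 1) (ψ : AddChar F ℂ) (y : F) :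
    ∑ x : F, ψ (y * x ^ 3) = 3 * cubicPeriod ψ y + 1 := by
  classical
  rw [FiniteField.sum_comp_cube hn (fun x => ψ (y * x)), cubicPeriod, mul_zero,
    AddChar.map_zero_eq_one, nsmul_eq_mul, add_comm]
  norm_num

theorem cubicPeriod_mul_cube (hn : Fintype.card F = 3 * n + 1) (ψ : AddChar F ℂ) (y : F) {z : F}
    (hz : z ≠ 0) : cubicPeriod ψ (y * z ^ 3) = cubicPeriod ψ y := by
  have h1 := sum_addChar_mul_cube hn ψ y
  rw [← Equiv.sum_comp (Equiv.mulLeft₀ z hz)] at h1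
  simp only [Equiv.mulLeft₀_apply, mul_pow, ← mul_assoc] at h1
  rw [sum_addChar_mul_cube hn ψ (y * z ^ 3)] at h1
  linear_combination h1 / 3

theorem cubicPeriod_neg (hn : Fintype.card F = 3 * n + 1) (ψ : AddChar F ℂ) (y : F) :
    cubicPeriod ψ (-y) = cubicPeriod ψ y := by
  rw [← cubicPeriod_mul_cube hn ψ y (neg_ne_zero.mpr one_ne_zero)]
  congr 1
  ring

theorem Complex.eq_intCast_of_isIntegral_of_mul_eq {z : ℂ} (hz : IsIntegral ℤ z) {a b : ℤ}
    (ha : a ≠ 0) (h : a * z = b) : ∃ e : ℤ, z = e := by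
  have ha' : (a : ℂ) ≠ 0 := by exact_mod_cast ha
  have hr : z = algebraMap ℚ ℂ (b / a) := by
    rw [eq_ratCast]
    push_cast
    rw [eq_div_iff ha', mul_comm]
    exact h
  rw [hr, isIntegral_algebraMap_iff (algebraMap ℚ ℂ).injective] at hz
  obtain ⟨e, he⟩ := IsIntegrallyClosed.isIntegral_iff.mp hz
  refine ⟨e, ?_⟩
  rw [hr, ← he]
  simp

theorem AddChar.pow_char_eq_one {F : Type*} [Field F] {p : ℕ} [CharP F p] (ψ : AddChar F ℂ) (x : F) :
    ψ x ^ p = 1 := by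
  rw [← AddChar.map_nsmul_eq_pow, nsmul_eq_mul, CharP.cast_eq_zero, zero_mul,
    AddChar.map_zero_eq_one]

/-- The cubic periods are rational integers as soon as the prime field consists of cubes. -/
theorem exists_int_cubicPeriod {p : ℕ} [CharP F p] (hp : p.Prime)
    (hn : Fintype.card F = 3 * n + 1)
    (hcube : ∀ c : ℕ, c ≠ 0 → c < p → ∃ z : F, z ≠ 0 ∧ (c : F) = z ^ 3)
    (ψ : AddChar F ℂ) (y : F) : ∃ e : ℤ, cubicPeriod ψ y = e := by
  classical
  have hint : IsIntegral ℤ (cubicPeriod ψ y) := by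
    refine IsIntegral.sum _ fun x _ => IsIntegral.of_pow hp.pos ?_
    rw [AddChar.pow_char_eq_one]
    exact isIntegral_one
  have hinner : ∀ x : F, ∑ c ∈ range p, ψ ((c : F) * x) = if ψ x = 1 then (p : ℂ) else 0 := by
    intro x
    have h1 : ∀ c : ℕ, ψ ((c : F) * x) = ψ x ^ c := fun c => by
      rw [← nsmul_eq_mul, AddChar.map_nsmul_eq_pow]
    simp_rw [h1]
    split_ifs with h
    · simp [h]
    · have := geom_sum_mul (ψ x) p
      rw [AddChar.pow_char_eq_one, sub_self] at this
      exact (mul_eq_zero.mp this).resolve_right (sub_ne_zero.mpr h)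
  -- Evaluating this double sum in both orders gives a linear equation for the period with integer
  -- coefficients: for `c ≠ 0` the factor `c` is a cube and leaves the inner sum unchanged. An
  -- algebraic integer that is rational is an integer.
  have hswap : ∑ c ∈ range p, ∑ x : F, ψ ((c : F) * (y * x ^ 3)) =
      p * #{x : F | ψ (y * x ^ 3) = 1} := by
    rw [sum_comm]
    simp_rw [hinner]
    rw [← sum_filter, sum_const, nsmul_eq_mul, mul_comm]
  have hsum : ∑ c ∈ range p, ∑ x : F, ψ ((c : F) * (y * x ^ 3)) =
      (3 * n + 1 : ℕ) + (p - 1 : ℕ) * (3 * cubicPeriod ψ y + 1) := by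
    rw [← sum_erase_add _ _ (mem_range.mpr hp.pos), add_comm]
    congr 1
    · simp [hn]
    · rw [sum_congr rfl (g := fun _ => 3 * cubicPeriod ψ y + 1)]
      · rw [sum_const, card_erase_of_mem (mem_range.mpr hp.pos), card_range, nsmul_eq_mul]
      · intro c hc
        obtain ⟨z, hz, hcz⟩ := hcube c (ne_of_mem_erase hc) (mem_range.mp (mem_of_mem_erase hc))
        rw [← cubicPeriod_mul_cube hn ψ y hz, ← sum_addChar_mul_cube hn]
        refine sum_congr rfl fun x _ => ?_
        rw [hcz]
        congr 1
        ring
  refine Complex.eq_intCast_of_isIntegral_of_mul_eq hint (a := 3 * (p - 1 : ℕ))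
    (b := p * #{x : F | ψ (y * x ^ 3) = 1} - (3 * n + 1 : ℕ) - (p - 1 : ℕ)) ?_ ?_
  · have := hp.two_le
    omega
  · rw [hswap] at hsum
    push_cast at hsum ⊢
    linear_combination -hsum

theorem sum_sum_addChar_mul [DecidableEq F] {ψ : AddChar F ℂ} (hψ : ψ.IsPrimitive)
    {ι : Type*} [Fintype ι] (h : ι → F) :
    ∑ y : F, ∑ i, ψ (y * h i) = Fintype.card F * #{i | h i = 0} := by
  rw [sum_comm]
  simp_rw [AddChar.sum_mulShift _ hψ]
  push_cast
  rw [← sum_filter, sum_const, nsmul_eq_mul, mul_comm]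

/-- Expanding the `k`-th power of `∑ ψ (y * x ^ 3)` and summing over `y`, orthogonality leaves `q`
times the number of zeros of the diagonal cubic form in `k` variables. -/
theorem sum_cubicPeriod_moments [DecidableEq F] (hn : Fintype.card F = 3 * n + 1)
    {ψ : AddChar F ℂ} (hψ : ψ.IsPrimitive) :
    ∑ y : F, (3 * cubicPeriod ψ y + 1) = 3 * (n : ℂ) + 1 ∧
    ∑ y : F, (3 * cubicPeriod ψ y + 1) ^ 2 = (3 * (n : ℂ) + 1) * (9 * n + 1) ∧
    ∑ y : F, (3 * cubicPeriod ψ y + 1) ^ 3 =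
      (3 * (n : ℂ) + 1) * #{v : F × F × F | v.1 ^ 3 + v.2.1 ^ 3 + v.2.2 ^ 3 = 0} := by
  simp_rw [← sum_addChar_mul_cube hn]
  refine ⟨?_, ?_, ?_⟩
  · have : ({x : F | x ^ 3 = 0} : Finset F) = {0} := by ext; simp
    rw [sum_sum_addChar_mul hψ, this, hn]
    simp
  · have := sum_sum_addChar_mul hψ (fun v : F × F => v.1 ^ 3 + v.2 ^ 3)
    rw [FiniteField.card_binary_cubic_zeros hn, hn] at this
    push_cast at this
    rw [← this]
    refine sum_congr rfl fun y _ => ?_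
    rw [sq, sum_mul_sum, Fintype.sum_prod_type]
    simp_rw [mul_add, AddChar.map_add_eq_mul]
  · have := sum_sum_addChar_mul hψ (fun v : F × F × F => v.1 ^ 3 + v.2.1 ^ 3 + v.2.2 ^ 3)
    rw [hn] at this
    push_cast at this
    rw [← this]
    refine sum_congr rfl fun y _ => ?_
    rw [pow_succ', sq, sum_mul_sum, sum_mul_sum, Fintype.sum_prod_type]
    refine sum_congr rfl fun a _ => ?_
    rw [Fintype.sum_prod_type]
    refine sum_congr rfl fun b _ => ?_
    rw [mul_sum]
    refine sum_congr rfl fun c _ => ?_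
    rw [mul_add, mul_add, AddChar.map_add_eq_mul, AddChar.map_add_eq_mul, mul_assoc]

/-- The values of the cubic periods. -/
theorem exists_cubicPeriod_values {p m : ℕ} [CharP F p] [DecidableEq F] (hp : p.Prime)
    (hodd : p ≠ 2) (hm : 0 < m) (hF : Fintype.card F = p ^ m)
    (hn : Fintype.card F = 3 * n + 1)
    (hcube : ∀ c : ℕ, c ≠ 0 → c < p → ∃ z : F, z ≠ 0 ∧ (c : F) = z ^ 3)
    {ψ : AddChar F ℂ} (hψ : ψ.IsPrimitive) :
    ∃ e₀ e₁ e₂ c : ℤ,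
      (univ.erase (0 : F)).val.map (cubicPeriod ψ) =
        n • (({e₀, e₁, e₂} : Multiset ℤ).map fun e : ℤ => (e : ℂ)) ∧
      (3 * e₀ + 1) + (3 * e₁ + 1) + (3 * e₂ + 1) = 0 ∧
      (3 * e₀ + 1) ^ 2 + (3 * e₁ + 1) ^ 2 + (3 * e₂ + 1) ^ 2 = 6 * (p : ℤ) ^ m ∧
      (3 * e₀ + 1) * (3 * e₁ + 1) * (3 * e₂ + 1) = (p : ℤ) ^ m * c ∧
      (p ≡ 1 [MOD 3] → ¬ (p : ℤ) ∣ c) := by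
  have hn0 : n ≠ 0 := by
    rintro rfl
    have := Fintype.one_lt_card (α := F)
    omega
  obtain ⟨g, hg, hmap⟩ := FiniteField.exists_map_erase_zero hn
  choose e he using exists_int_cubicPeriod hp hn hcube ψ
  have hper : ∀ x z : F, z ≠ 0 → cubicPeriod ψ (x * z ^ 3) = cubicPeriod ψ x :=
    fun x z hz => cubicPeriod_mul_cube hn ψ x hz
  have hsum : ∀ k : ℕ, ∑ y : F, (3 * cubicPeriod ψ y + 1) ^ k = (3 * n + 1) ^ k +
      n * ((3 * e 1 + 1) ^ k + (3 * e g + 1) ^ k + (3 * e (g ^ 2) + 1) ^ k) := by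
    intro k
    rw [← add_sum_erase univ _ (mem_univ (0 : F)), cubicPeriod_zero hn]
    congr 1
    rw [sum_eq_multiset_sum, hmap (fun y => (3 * cubicPeriod ψ y + 1) ^ k)
      (fun x z hz => by simp only [hper x z hz])]
    simp only [Multiset.sum_nsmul, Multiset.insert_eq_cons, Multiset.sum_cons,
      Multiset.sum_singleton, he, nsmul_eq_mul]
    ring
  obtain ⟨h1, h2, h3⟩ := sum_cubicPeriod_moments hn hψ
  have k1 := hsum 1
  simp only [pow_one] at k1
  rw [h1] at k1
  have k2 := hsum 2
  rw [h2] at k2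
  have k3 := hsum 3
  rw [h3] at k3
  set N₃ := #{v : F × F × F | v.1 ^ 3 + v.2.1 ^ 3 + v.2.2 ^ 3 = 0} with hN₃
  have hnZ : (n : ℤ) ≠ 0 := by exact_mod_cast hn0
  have hqZ : (p : ℤ) ^ m = 3 * n + 1 := by rw [hF] at hn; exact_mod_cast hn
  have s1 : (3 * e 1 + 1) + (3 * e g + 1) + (3 * e (g ^ 2) + 1) = 0 := by
    have : (n : ℤ) * ((3 * e 1 + 1) + (3 * e g + 1) + (3 * e (g ^ 2) + 1)) = 0 := by
      have : (n : ℂ) * ((3 * e 1 + 1) + (3 * e g + 1) + (3 * e (g ^ 2) + 1)) = 0 := by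
        linear_combination -k1
      exact_mod_cast this
    exact (mul_eq_zero.mp this).resolve_left hnZ
  have s2 : (3 * e 1 + 1) ^ 2 + (3 * e g + 1) ^ 2 + (3 * e (g ^ 2) + 1) ^ 2
      = 6 * (3 * (n : ℤ) + 1) := by
    have : (n : ℂ) * ((3 * e 1 + 1) ^ 2 + (3 * e g + 1) ^ 2 + (3 * e (g ^ 2) + 1) ^ 2) =
        n * (6 * (3 * n + 1)) := by linear_combination -k2
    exact mul_left_cancel₀ hnZ (by exact_mod_cast this)
  have s3 : (3 * (n : ℤ) + 1) * N₃ = (3 * n + 1) ^ 3 +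
      n * ((3 * e 1 + 1) ^ 3 + (3 * e g + 1) ^ 3 + (3 * e (g ^ 2) + 1) ^ 3) := by
    exact_mod_cast k3
  set P := (3 * e 1 + 1) * (3 * e g + 1) * (3 * e (g ^ 2) + 1) with hP
  -- Since the three numbers sum to `0`, their cubes sum to `3P`, and the third moment reads `qN₃ =
  -- q³ + (q - 1)P`. The cofactor of `q` found here is the witness for `c`.
  have s4 : P = (3 * (n : ℤ) + 1) * (P + (3 * n + 1) ^ 2 - N₃) := by
    have : (3 * e 1 + 1) ^ 3 + (3 * e g + 1) ^ 3 + (3 * e (g ^ 2) + 1) ^ 3 = 3 * P := by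
      have s1' : e (g ^ 2) = -e 1 - e g - 1 := by linarith
      rw [hP, s1']
      ring
    rw [this] at s3
    linear_combination s3
  refine ⟨e 1, e g, e (g ^ 2), _, ?_, s1, by rw [hqZ, s2], by rw [hqZ, ← hP]; exact s4, ?_⟩
  · rw [hmap (cubicPeriod ψ) hper]
    simp [he]
  · intro h3 hdvd
    have hpq : (p : ℤ) ∣ 3 * n + 1 := hqZ ▸ dvd_pow_self _ hm.ne'
    have hpP : (p : ℤ) ∣ P := by rw [s4]; exact hpq.mul_right _
    -- Modulo `p` the cofactor is `-N₃`, so `p ∣ c` would give `p ∣ (2n choose n)`.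
    have hpN : (p : ℤ) ∣ N₃ := by
      have : (N₃ : ℤ) = P + (3 * n + 1) ^ 2 - (P + (3 * n + 1) ^ 2 - N₃) := by ring
      rw [this]
      exact dvd_sub (dvd_add hpP (dvd_pow hpq two_ne_zero)) hdvd
    have heven : Even n := by
      have : Odd (3 * n + 1) := by
        rw [← hn, hF]
        exact (hp.odd_of_ne_two hodd).pow
      rcases Nat.even_or_odd n with h | h
      · exact h
      · obtain ⟨a, ha⟩ := this
        obtain ⟨b, hb⟩ := h
        omega
    have hcast := FiniteField.cast_card_ternary_cubic_zeros hn heven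
    rw [← hN₃, (CharP.cast_eq_zero_iff F p N₃).mpr (by exact_mod_cast hpN), eq_comm,
      CharP.cast_eq_zero_iff F p] at hcast
    obtain ⟨k, hk⟩ := (Nat.modEq_iff_dvd' hp.one_lt.le).mp h3.symm
    -- With `p - 1 = 3k` all base-`p` digits of `n` equal `k`, and `2k < p` rules out carries in `n
    -- + n`.
    have hgeom : n = k * ∑ l ∈ range m, p ^ l := by
      have h5 : (∑ l ∈ range m, p ^ l) * (p - 1) + 1 = p ^ m := by
        have := geom_sum_mul_add (p - 1) m
        rwa [Nat.sub_add_cancel hp.one_lt.le] at this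
      rw [hk, ← hF, hn] at h5
      nlinarith
    have := Nat.not_dvd_choose_geom (i := 1) (j := 1) (k := k) hp
      (by have := hp.two_le; omega) m
    rw [one_mul, ← hgeom] at this
    exact this hcast

end Periods

/-! ### Diagonalisation of both graphs, and connectedness. -/

theorem Matrix.roots_charpoly_of_mul_eq_mul_diagonal {ι K : Type*} [Fintype ι] [DecidableEq ι]
    [Field K] {A B Q : Matrix ι ι K} {c d : ι → K} (hBQ : B * Q = Matrix.diagonal c)
    (hc : ∀ i, c i ≠ 0) (hAQ : A * Q = Q * Matrix.diagonal d) :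
    A.charpoly.roots = univ.val.map d := by
  have hQ : IsUnit Q := by
    rw [Matrix.isUnit_iff_isUnit_det]
    have h : B.det * Q.det = ∏ i, c i := by rw [← Matrix.det_mul, hBQ, Matrix.det_diagonal]
    refine isUnit_iff_ne_zero.mpr fun h0 => ?_
    rw [h0, mul_zero] at h
    exact prod_ne_zero_iff.mpr (fun i _ => hc i) h.symm
  obtain ⟨U, rfl⟩ := hQ
  have hA : A = U.val * Matrix.diagonal d * U.val⁻¹ := by
    rw [← hAQ, ← Matrix.coe_units_inv, mul_assoc, Units.mul_inv, mul_one]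
  rw [hA, Matrix.charpoly_units_conj, Matrix.charpoly_diagonal]
  have := Polynomial.roots_multiset_prod_X_sub_C (univ.val.map d)
  rwa [Multiset.map_map] at this

/-- Any enumeration of the group selects the smaller element of each pair `{y, -y}`; this choice
distributes the signs of the eigenvalues. -/
theorem exists_half_of_neg_ne {G : Type*} [AddCommGroup G] [Fintype G]
    (h2 : ∀ y : G, y ≠ 0 → -y ≠ y) :
    ∃ H : Finset G, 0 ∉ H ∧ ∀ y, y ≠ 0 → (-y ∈ H ↔ y ∉ H) := by
  classical
  let e := Fintype.equivFin G
  refine ⟨univ.filter fun y => e y < e (-y), by simp, fun y hy => ?_⟩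
  have : e y ≠ e (-y) := fun h => h2 y hy (e.injective h).symm
  simp only [mem_filter, mem_univ, true_and, neg_neg, not_lt]
  exact ⟨le_of_lt, fun h => lt_of_le_of_ne h this.symm⟩

section Spectrum

variable {F : Type*} [Field F] [Fintype F] {n : ℕ}

theorem gpGraph_adjacencyMatrix_mulVec (ψ : AddChar F ℂ) (v y : F) :
    ∑ w, (gpGraph 3 F).adjacencyMatrix v w * ψ (w * y) = ψ (v * y) * cubicPeriod ψ y := by
  classical
  rw [← Equiv.sum_comp (Equiv.addLeft v), cubicPeriod, mul_sum, sum_filter]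
  refine sum_congr rfl fun x _ => ?_
  simp only [Digraph.adjacencyMatrix, gpGraph, cayleyDigraph, Matrix.of_apply, Equiv.coe_addLeft,
    add_sub_cancel_left, ite_mul, one_mul, zero_mul, add_mul, AddChar.map_add_eq_mul, mul_comm x y]

theorem gpSumGraph_adjacencyMatrix_mulVec (ψ : AddChar F ℂ) (v y : F) :
    ∑ w, (gpSumGraph 3 F).adjacencyMatrix v w * ψ (w * y) = ψ (-v * y) * cubicPeriod ψ y := by
  classical
  rw [← Equiv.sum_comp (Equiv.addLeft (-v)), cubicPeriod, mul_sum, sum_filter]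
  refine sum_congr rfl fun x _ => ?_
  simp only [Digraph.adjacencyMatrix, gpSumGraph, cayleySumDigraph, Matrix.of_apply,
    Equiv.coe_addLeft, add_neg_cancel_left, ite_mul, one_mul, zero_mul, add_mul,
    AddChar.map_add_eq_mul, mul_comm x y]

theorem gpGraph_eigenvalues {ψ : AddChar F ℂ} (hψ : ψ.IsPrimitive) :
    (gpGraph 3 F).eigenvalues = univ.val.map (cubicPeriod ψ) := by
  classical
  refine Matrix.roots_charpoly_of_mul_eq_mul_diagonal
    (B := Matrix.of fun x w => ψ (w * -x)) (Q := Matrix.of fun w y => ψ (w * y))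
    (c := fun _ => (Fintype.card F : ℂ)) ?_ (fun _ => Nat.cast_ne_zero.mpr Fintype.card_ne_zero) ?_
  · ext x y
    simp only [Matrix.mul_apply, Matrix.of_apply, ← AddChar.map_add_eq_mul, ← mul_add]
    rw [AddChar.sum_mulShift _ hψ, Matrix.diagonal_apply]
    simp [neg_add_eq_zero]
  · ext v y
    rw [Matrix.mul_diagonal]
    simp only [Matrix.mul_apply, Matrix.of_apply]
    exact gpGraph_adjacencyMatrix_mulVec ψ v y

/-- The matrix swaps the characters of `y` and `-y` up to the common factor `η(y)`, so their
combination with sign `ε y` is an eigenvector. Oddness of `ε` off `0` makes each pair contribute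
both signs. -/
theorem gpSumGraph_eigenvalues (hn : Fintype.card F = 3 * n + 1) {ψ : AddChar F ℂ}
    (hψ : ψ.IsPrimitive) {ε : F → ℂ} (hε0 : ε 0 = 1) (hε : ∀ y, ε y * ε y = 1)
    (hneg : ∀ y, y ≠ 0 → ε (-y) = -ε y) :
    (gpSumGraph 3 F).eigenvalues = univ.val.map fun y => ε y * cubicPeriod ψ y := by
  classical
  have hq : (Fintype.card F : ℂ) ≠ 0 := Nat.cast_ne_zero.mpr Fintype.card_ne_zero
  refine Matrix.roots_charpoly_of_mul_eq_mul_diagonal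
    (B := Matrix.of fun x w => ψ (w * -x) + ε x * ψ (w * x))
    (Q := Matrix.of fun w y => ψ (w * y) + ε y * ψ (w * -y))
    -- At `x = 0` the two characters coincide and all four products contribute `q`; elsewhere only
    -- two do.
    (c := fun x => if x = 0 then 4 * (Fintype.card F : ℂ) else 2 * Fintype.card F) ?_
    (fun x => by split_ifs <;> simp [hq]) ?_
  · ext x y
    have key : ∀ w : F, (ψ (w * -x) + ε x * ψ (w * x)) * (ψ (w * y) + ε y * ψ (w * -y)) =
        ψ (w * (-x + y)) + ε y * ψ (w * (-x + -y)) + ε x * ψ (w * (x + y)) +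
          ε x * ε y * ψ (w * (x + -y)) := by
      intro w
      simp only [mul_add, AddChar.map_add_eq_mul]
      ring
    simp only [Matrix.mul_apply, Matrix.of_apply, key, sum_add_distrib, ← mul_sum,
      AddChar.sum_mulShift _ hψ, Matrix.diagonal_apply,
      add_eq_zero_iff_eq_neg, neg_eq_iff_eq_neg, neg_neg]
    by_cases hxy : x = y
    · subst hxy
      by_cases hx : x = 0
      · subst hx
        simp only [neg_zero, if_true, hε0]
        ring
      · by_cases hx' : x = -x
        · have := hneg x hx
          rw [← hx'] at this
          have h0 : ε x = 0 := by linear_combination this / 2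
          have := hε x
          simp [h0] at this
        · simp only [if_true, hx, hx', if_false, hε]
          push_cast
          ring
    · by_cases hx' : x = -y
      · have hy : y ≠ 0 := by rintro rfl; exact hxy (by simpa using hx')
        subst hx'
        simp [hxy, hneg y hy]
      · simp [hxy, hx']
  · ext v y
    rw [Matrix.mul_diagonal]
    simp only [Matrix.mul_apply, Matrix.of_apply]
    have h1 := gpSumGraph_adjacencyMatrix_mulVec ψ v y
    have h2 := gpSumGraph_adjacencyMatrix_mulVec ψ v (-y)
    rw [cubicPeriod_neg hn] at h2
    have : ∀ w, (gpSumGraph 3 F).adjacencyMatrix v w * (ψ (w * y) + ε y * ψ (w * -y)) =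
        (gpSumGraph 3 F).adjacencyMatrix v w * ψ (w * y) +
          ε y * ((gpSumGraph 3 F).adjacencyMatrix v w * ψ (w * -y)) := fun w => by ring
    simp only [this, sum_add_distrib, ← mul_sum, h1, h2]
    rw [show -v * -y = v * y by ring, show v * -y = -v * y by ring]
    linear_combination (-cubicPeriod ψ y * ψ (-v * y)) * hε y

theorem exists_eigenvalues_eq (hn : Fintype.card F = 3 * n + 1) [DecidableEq F]
    (h2 : (2 : F) ≠ 0) {ψ : AddChar F ℂ} (hψ : ψ.IsPrimitive) :
    ∃ N : Multiset ℂ, (univ.erase (0 : F)).val.map (cubicPeriod ψ) = N + N ∧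
      (gpGraph 3 F).eigenvalues = (n : ℂ) ::ₘ (N + N) ∧
      (gpSumGraph 3 F).eigenvalues = (n : ℂ) ::ₘ (N + N.map fun x => -x) := by
  obtain ⟨H, h0, hH⟩ := exists_half_of_neg_ne (G := F) fun y hy h =>
    hy ((mul_eq_zero.mp (show 2 * y = 0 by linear_combination -h)).resolve_left h2)
  have hne : ∀ y ∈ H, y ≠ 0 := fun y hy => by rintro rfl; exact h0 hy
  have hmem : ∀ y ∈ H, -y ∉ H := fun y hy h => (hH y (hne y hy)).mp h hy
  have hdisj : Disjoint H (H.map (Equiv.neg F).toEmbedding) := by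
    rw [disjoint_left]
    intro y hy hy'
    obtain ⟨z, hz, rfl⟩ := mem_map.mp hy'
    exact hmem z hz (by simpa using hy)
  have huniv : univ.erase (0 : F) = H.disjUnion (H.map (Equiv.neg F).toEmbedding) hdisj := by
    ext y
    simp only [mem_erase, mem_univ, and_true, mem_disjUnion, mem_map_equiv, Equiv.neg_symm,
      Equiv.neg_apply]
    constructor
    · intro hy
      rw [hH y hy]
      exact em _
    · rintro (hy | hy)
      · exact hne y hy
      · exact neg_ne_zero.mp (hne _ hy)
  have hval : (univ.erase (0 : F)).val = H.val + H.val.map fun y => -y := by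
    rw [huniv, disjUnion_val, map_val]
    rfl
  have hval0 : (univ : Finset F).val = 0 ::ₘ (H.val + H.val.map fun y => -y) := by
    rw [← hval, erase_val, Multiset.cons_erase (mem_univ_val 0)]
  have hN : (univ.erase (0 : F)).val.map (cubicPeriod ψ) =
      H.val.map (cubicPeriod ψ) + H.val.map (cubicPeriod ψ) := by
    rw [hval, Multiset.map_add, Multiset.map_map]
    simp only [Function.comp_def, cubicPeriod_neg hn]
  refine ⟨H.val.map (cubicPeriod ψ), hN, ?_, ?_⟩
  · rw [gpGraph_eigenvalues hψ, ← hN, hval0, Multiset.map_cons, cubicPeriod_zero hn, hval]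
  -- `ε` is `-1` on `-H` and `1` on `H` and at `0`.
  · rw [gpSumGraph_eigenvalues hn hψ (ε := fun y => if -y ∈ H then -1 else 1) (by simp [h0])
      (fun y => by split_ifs <;> norm_num)
      (fun y hy => by
        have := hH y hy
        simp only [neg_neg]
        split_ifs <;> simp_all), hval0, Multiset.map_cons, Multiset.map_add, Multiset.map_map,
      Multiset.map_map, cubicPeriod_zero hn]
    congr 1
    · simp [h0]
    · congr 1
      · refine Multiset.map_congr rfl fun y hy => ?_
        rw [if_neg (hmem y hy), one_mul]
      · refine Multiset.map_congr rfl fun y hy => ?_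
        have hy' : y ∈ H := hy
        simp [hy', cubicPeriod_neg hn]

theorem gpSumGraph_three_isConnected (hn : Fintype.card F = 3 * n + 1) (h2 : (2 : F) ≠ 0)
    (hodd : Odd (Fintype.card F)) : (gpSumGraph 3 F).IsConnected := by
  classical
  set Γ := (gpSumGraph 3 F).toSimpleGraphInclusive
  have hadj : ∀ v r : F, r ∈ nonzeroPowers 3 F → Γ.Reachable v (r - v) := by
    intro v r hr
    by_cases h : v = r - v
    · rw [← h]
    · refine SimpleGraph.Adj.reachable ⟨h, Or.inl ?_⟩
      change v + (r - v) ∈ nonzeroPowers 3 F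
      rwa [add_sub_cancel]
  let K : AddSubgroup F :=
    { carrier := {d | ∀ v, Γ.Reachable v (v + d)}
      zero_mem' := fun v => by rw [add_zero]
      add_mem' := fun {a b} ha hb v => by
        rw [← add_assoc]
        exact (ha v).trans (hb _)
      neg_mem' := fun {a} ha v => by
        have := ha (v + -a)
        rw [neg_add_cancel_right] at this
        exact this.symm }
  -- The walk `v → -r - v → v + 2r` uses the sums `-r` and `r`, both cubes.
  have hK : ∀ r ∈ nonzeroPowers 3 F, 2 * r ∈ K := by
    intro r hr v
    have h1 := hadj v (-r) (neg_mem_nonzeroPowers_three hr)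
    have h3 := hadj (-r - v) r hr
    rw [show r - (-r - v) = v + 2 * r by ring] at h3
    exact h1.trans h3
  have hcard : n + 1 ≤ Nat.card K := by
    have h3 : (insert 0 (({x : F | x ∈ nonzeroPowers 3 F} : Finset F).image (2 * ·)) :
        Finset F) ⊆ univ.filter fun x : F => x ∈ K := by
      intro x hx
      rw [mem_filter]
      refine ⟨mem_univ _, ?_⟩
      rcases mem_insert.mp hx with rfl | hx
      · exact K.zero_mem
      · obtain ⟨r, hr, rfl⟩ := mem_image.mp hx
        exact hK r (mem_filter.mp hr).2
    have h4 := card_le_card h3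
    rw [card_insert_of_notMem, card_image_of_injective _ (mul_right_injective₀ h2),
      FiniteField.card_nonzero_cubes hn] at h4
    · rw [Nat.card_eq_fintype_card, Fintype.card_subtype]
      exact h4
    · rw [mem_image]
      rintro ⟨r, hr, h5⟩
      obtain ⟨z, hz, rfl⟩ := (mem_filter.mp hr).2
      exact mul_ne_zero h2 (pow_ne_zero 3 hz) h5
  have hidx := K.card_mul_index
  rw [Nat.card_eq_fintype_card (α := F), hn] at hidx
  rw [hn, ← hidx] at hodd
  have hodd' := (Nat.odd_mul.mp hodd).2
  -- Index at least 3 would need `3(n + 1) > q` elements, and the index is odd because it divides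
  -- `q`.
  have hone : K.index = 1 := by
    have h3 : K.index < 3 := by
      by_contra hge
      push Not at hge
      have := Nat.mul_le_mul hcard hge
      omega
    obtain ⟨k, hk⟩ := hodd'
    omega
  have htop : K = ⊤ := AddSubgroup.index_eq_one.mp hone
  change Γ.Connected
  refine ⟨fun v w => ?_⟩
  have : w - v ∈ K := htop ▸ AddSubgroup.mem_top _
  simpa using this v

end Spectrum

/-! ### Explicit spectra and distinctness of the eigenvalues. -/

theorem Digraph.HasSpectrum.of_eigenvalues_eq_two {V : Type*} [Fintype V] {Γ : Digraph V}
    {n i j : ℕ} {f g : ℤ} {N : Multiset ℂ}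
    (hΓ : Γ.eigenvalues = (n : ℂ) ::ₘ (N + N.map fun x => -x))
    (hN : N = i • {(f : ℂ)} + j • {(g : ℂ)}) (hi : 0 < i) (hj : 0 < j)
    (hnodup : ([(n : ℤ), f, -f, g, -g]).Nodup) :
    Γ.HasSpectrum [((n : ℂ), 1), ((f : ℂ), i), (-(f : ℂ), i), ((g : ℂ), j), (-(g : ℂ), j)] := by
  refine ⟨?_, by simp [hi, hj], ?_⟩
  · have := hnodup.map (f := fun z : ℤ => (z : ℂ)) Int.cast_injective
    simpa using this
  · rw [hΓ, hN]
    simp only [Multiset.map_add, Multiset.map_nsmul, Multiset.map_singleton, List.map_cons,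
      List.map_nil, List.sum_cons, List.sum_nil, ← Multiset.nsmul_singleton,
      ← Multiset.singleton_add]
    abel

theorem Digraph.HasSpectrum.of_eigenvalues_eq_three {V : Type*} [Fintype V] {Γ : Digraph V}
    {n k : ℕ} {f g h : ℤ} {N : Multiset ℂ}
    (hΓ : Γ.eigenvalues = (n : ℂ) ::ₘ (N + N.map fun x => -x))
    (hN : N = k • {(f : ℂ)} + k • {(g : ℂ)} + k • {(h : ℂ)}) (hk : 0 < k)
    (hnodup : ([(n : ℤ), f, -f, g, -g, h, -h]).Nodup) :
    Γ.HasSpectrum [((n : ℂ), 1), ((f : ℂ), k), (-(f : ℂ), k), ((g : ℂ), k), (-(g : ℂ), k),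
      ((h : ℂ), k), (-(h : ℂ), k)] := by
  refine ⟨?_, by simp [hk], ?_⟩
  · have := hnodup.map (f := fun z : ℤ => (z : ℂ)) Int.cast_injective
    simpa using this
  · rw [hΓ, hN]
    simp only [Multiset.map_add, Multiset.map_nsmul, Multiset.map_singleton, List.map_cons,
      List.map_nil, List.sum_cons, List.sum_nil, ← Multiset.nsmul_singleton,
      ← Multiset.singleton_add]
    abel

/-- Every `3x + 1` with `x` among `n, f, g, h` is divisible by `p`, so `x + y = 0` would give `p ∣
2`. Size separates `n` from the others; `3 ∤ a` and `b ≠ 0` separate `f, g, h`. -/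
theorem CubicConditions.nodup {p t n : ℕ} {a b f g h : ℤ} (hp : p.Prime) (hodd : p ≠ 2)
    (h3 : p ≡ 1 [MOD 3]) (ht : 0 < t) (hab : CubicConditions p t a b)
    (hn : 3 * (n : ℤ) + 1 = (p : ℤ) ^ (3 * t)) (hf : 3 * f + 1 = a * (p : ℤ) ^ t)
    (hg : 2 * (3 * g + 1) = -(a + 9 * b) * (p : ℤ) ^ t)
    (hh : 2 * (3 * h + 1) = -(a - 9 * b) * (p : ℤ) ^ t) :
    ([(n : ℤ), f, -f, g, -g, h, -h]).Nodup := by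
  have hpZ : Prime (p : ℤ) := Nat.prime_iff_prime_int.mp hp
  have hp2 : ¬ (p : ℤ) ∣ 2 := fun h => hodd
    ((Nat.prime_dvd_prime_iff_eq hp Nat.prime_two).mp (by exact_mod_cast h))
  have hpa := hab.not_dvd hp
  obtain ⟨h4, ha3, -⟩ := hab
  have hp5 : 5 ≤ p := by
    have := hp.two_le
    have h3' : p % 3 = 1 := h3
    obtain ⟨u, hu⟩ := hp.odd_of_ne_two hodd
    omega
  rw [mul_comm 3 t, pow_mul] at hn
  have hps : (p : ℤ) ∣ (p : ℤ) ^ t := dvd_pow_self _ ht.ne'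
  have hs5 : 5 ≤ (p : ℤ) ^ t := by
    have : p ^ 1 ≤ p ^ t := Nat.pow_le_pow_right hp.pos ht
    rw [pow_one] at this
    exact_mod_cast (by omega : 5 ≤ p ^ t)
  generalize (p : ℤ) ^ t = s at *
  have hs3 : 25 * s ≤ s ^ 3 := by nlinarith [mul_nonneg (sub_nonneg.mpr hs5) (sub_nonneg.mpr hs5)]
  have df : (p : ℤ) ∣ 3 * f + 1 := hf ▸ hps.mul_left _
  have dg : (p : ℤ) ∣ 3 * g + 1 := (hpZ.dvd_or_dvd (hg ▸ hps.mul_left _)).resolve_left hp2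
  have dh : (p : ℤ) ∣ 3 * h + 1 := (hpZ.dvd_or_dvd (hh ▸ hps.mul_left _)).resolve_left hp2
  have dn : (p : ℤ) ∣ 3 * n + 1 := hn ▸ dvd_pow hps three_ne_zero
  have hadd : ∀ x y : ℤ, (p : ℤ) ∣ 3 * x + 1 → (p : ℤ) ∣ 3 * y + 1 → x + y ≠ 0 := by
    intro x y hx hy hxy
    have := dvd_add hx hy
    rw [show 3 * x + 1 + (3 * y + 1) = 2 by linarith] at this
    exact hp2 this
  have hsmall : ∀ x c : ℤ, 2 * (3 * x + 1) = c * s → c ^ 2 ≤ 16 * s → (n : ℤ) ≠ x := by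
    rintro x c hx hc rfl
    rw [hn] at hx
    have hc' : c = 2 * s ^ 2 := mul_right_cancel₀ (by positivity : s ≠ 0) (by linarith)
    rw [hc'] at hc
    nlinarith
  have ha : ¬ (3 : ℤ) ∣ a := by
    unfold Int.ModEq at ha3
    omega
  have hs0 : s ≠ 0 := by positivity
  have nf := hsmall f (2 * a) (by linarith) (by nlinarith [sq_nonneg b])
  -- `16s - (a + 9b)² = 3(a - 3b)²`.
  have ng := hsmall g _ hg (by nlinarith [sq_nonneg (a - 3 * b)])
  have nh := hsmall h _ hh (by nlinarith [sq_nonneg (a + 3 * b)])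
  have fg : f ≠ g := by
    rintro rfl
    have : 2 * a = -(a + 9 * b) := mul_right_cancel₀ hs0 (by linarith)
    omega
  have fh : f ≠ h := by
    rintro rfl
    have : 2 * a = -(a - 9 * b) := mul_right_cancel₀ hs0 (by linarith)
    omega
  have gh : g ≠ h := by
    rintro rfl
    have : -(a + 9 * b) = -(a - 9 * b) := mul_right_cancel₀ hs0 (by linarith)
    have hb : b = 0 := by linarith
    subst hb
    apply hpa
    apply hpZ.dvd_of_dvd_pow (n := 2)
    rw [show a ^ 2 = 4 * s by linarith]
    exact hps.mul_left _
  have := hadd f f df df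
  have := hadd g g dg dg
  have := hadd h h dh dh
  have := hadd f g df dg
  have := hadd f h df dh
  have := hadd g h dg dh
  have := hadd n f dn df
  have := hadd n g dn dg
  have := hadd n h dn dh
  simp only [List.nodup_cons, List.mem_cons, List.not_mem_nil, not_or, or_false,
    not_false_eq_true, List.nodup_nil, and_true]
  omega

theorem Multiset.add_self_injective {α : Type*} {s t : Multiset α} (h : s + s = t + t) :
    s = t := by
  classical
  ext x
  have := congrArg (Multiset.count x) h
  rw [Multiset.count_add, Multiset.count_add] at this
  omega

theorem theorem2p5 (p m : ℕ) (hp : p.Prime) (hodd : p ≠ 2)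
    (hdvd : 3 ∣ (p ^ m - 1) / (p - 1)) (hq : 5 ≤ p ^ m)
    (F : Type*) [Field F] [Fintype F] (hF : Fintype.card F = p ^ m)
    (n : ℕ) (hn : n = (p ^ m - 1) / 3) :
    -- the graph is connected with integral spectrum
    (gpSumGraph 3 F).IsConnected ∧
    (∀ x ∈ (gpSumGraph 3 F).eigenvalues, ∃ z : ℤ, x = (z : ℂ)) ∧
    -- the non-principal eigenvalues are `±` those of `Γ(3, q)`, with half the multiplicity each
    (∃ N : Multiset ℂ,
      (gpGraph 3 F).eigenvalues = (n : ℂ) ::ₘ (N + N) ∧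
      (gpSumGraph 3 F).eigenvalues = (n : ℂ) ::ₘ (N + N.map fun x => -x)) ∧
    -- the case `p ≡ 1 (mod 3)`; here `p ^ t` is the cube root of `q`
    (p ≡ 1 [MOD 3] → ∃ t : ℕ, m = 3 * t ∧
      (∃ a b : ℤ, CubicConditions p t a b) ∧
      (∀ a b a' b' : ℤ, CubicConditions p t a b → CubicConditions p t a' b' →
        a = a' ∧ (b = b' ∨ b = -b')) ∧
      ∀ a b : ℤ, CubicConditions p t a b →
        (gpSumGraph 3 F).HasSpectrum
          [((n : ℂ), 1),
           (((a : ℂ) * (p : ℂ) ^ t - 1) / 3, n / 2),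
           (-(((a : ℂ) * (p : ℂ) ^ t - 1) / 3), n / 2),
           ((-(1 / 2) * ((a : ℂ) + 9 * (b : ℂ)) * (p : ℂ) ^ t - 1) / 3, n / 2),
           (-((-(1 / 2) * ((a : ℂ) + 9 * (b : ℂ)) * (p : ℂ) ^ t - 1) / 3), n / 2),
           ((-(1 / 2) * ((a : ℂ) - 9 * (b : ℂ)) * (p : ℂ) ^ t - 1) / 3, n / 2),
           (-((-(1 / 2) * ((a : ℂ) - 9 * (b : ℂ)) * (p : ℂ) ^ t - 1) / 3), n / 2)]) ∧
    -- the case `p ≡ 2 (mod 3)`; here `p ^ t` is the square root of `q`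
    (p ≡ 2 [MOD 3] → ∃ t : ℕ, m = 2 * t ∧
      (m ≡ 0 [MOD 4] →
        (gpSumGraph 3 F).HasSpectrum
          [((n : ℂ), 1),
           (((p : ℂ) ^ t - 1) / 3, n),
           (-(((p : ℂ) ^ t - 1) / 3), n),
           ((-2 * (p : ℂ) ^ t - 1) / 3, n / 2),
           (-((-2 * (p : ℂ) ^ t - 1) / 3), n / 2)]) ∧
      (m ≡ 2 [MOD 4] →
        (gpSumGraph 3 F).HasSpectrum
          [((n : ℂ), 1),
           ((2 * (p : ℂ) ^ t - 1) / 3, n / 2),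
           (-((2 * (p : ℂ) ^ t - 1) / 3), n / 2),
           ((-(p : ℂ) ^ t - 1) / 3, n),
           (-((-(p : ℂ) ^ t - 1) / 3), n)])) := by
  classical
  have hm : 0 < m := by
    rcases Nat.eq_zero_or_pos m with rfl | h
    · simp at hq
    · exact h
  have hp1 : 1 < p := hp.one_lt
  have hgeom : ∑ i ∈ range m, p ^ i = (p ^ m - 1) / (p - 1) := Nat.geomSum_eq hp.two_le m
  rw [← hgeom] at hdvd
  obtain ⟨l, hl⟩ := hdvd
  have hql : p ^ m = 3 * (l * (p - 1)) + 1 := by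
    have := geom_sum_mul_add (p - 1) m
    rw [Nat.sub_add_cancel hp1.le, hl] at this
    rw [← this]
    ring
  have hnl : n = l * (p - 1) := by omega
  have hqn : p ^ m = 3 * n + 1 := by rw [hql, hnl]
  have hcard : Fintype.card F = 3 * n + 1 := hF.trans hqn
  have hqodd : Odd (p ^ m) := (hp.odd_of_ne_two hodd).pow
  obtain ⟨k, hk⟩ : ∃ k, n = k + k := by
    rcases Nat.even_or_odd n with h | ⟨b, hb⟩
    · exact h
    · obtain ⟨a, ha⟩ := hqodd
      omega
  have hkpos : 0 < k := by omega
  have hn2 : n / 2 = k := by omega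
  have hfact := Fact.mk hp
  have hchar : CharP F p := charP_of_card_eq_prime_pow hF
  have h2 : (2 : F) ≠ 0 := by
    intro h
    have : p ∣ 2 := (CharP.cast_eq_zero_iff F p 2).mp (by exact_mod_cast h)
    exact hodd ((Nat.prime_dvd_prime_iff_eq hp Nat.prime_two).mp this)
  -- By Fermat `c ^ (p - 1) = 1`, and `p - 1` divides `n`.
  have hcube : ∀ c : ℕ, c ≠ 0 → c < p → ∃ z : F, z ≠ 0 ∧ (c : F) = z ^ 3 := by
    intro c hc hcp
    apply FiniteField.exists_cube_of_pow_eq_one hcard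
    have h : c ^ (p - 1) ≡ 1 [MOD p] := by
      rw [← Nat.totient_prime hp]
      exact Nat.ModEq.pow_totient (Nat.coprime_of_lt_prime hc hcp hp).symm
    have h' := (CharP.natCast_eq_natCast F p).mpr h
    push_cast at h'
    rw [hnl, mul_comm, pow_mul, h', one_pow]
  have hψ := AddChar.FiniteField.primitiveChar_to_Complex_isPrimitive F
  obtain ⟨e₀, e₁, e₂, c, hval, hsum, hsq, hprod, hc⟩ :=
    exists_cubicPeriod_values hp hodd hm hF hcard hcube hψ
  obtain ⟨N, hNval, hΓ, hΓs⟩ := exists_eigenvalues_eq hcard h2 hψ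
  have hN : N = k • (({e₀, e₁, e₂} : Multiset ℤ).map fun e : ℤ => (e : ℂ)) := by
    apply Multiset.add_self_injective
    rw [← hNval, hval, hk, add_nsmul]
  refine ⟨gpSumGraph_three_isConnected hcard h2 (hF ▸ hqodd), ?_, ⟨N, hΓ, hΓs⟩, ?_, ?_⟩
  · have hNint : ∀ x ∈ N, ∃ z : ℤ, x = z := by
      intro x hx
      rw [hN] at hx
      obtain ⟨z, -, rfl⟩ := Multiset.mem_map.mp (Multiset.mem_of_mem_nsmul hx)
      exact ⟨z, rfl⟩
    intro x hx
    rw [hΓs, Multiset.mem_cons, Multiset.mem_add, Multiset.mem_map] at hx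
    rcases hx with rfl | hx | ⟨y, hy, rfl⟩
    · exact ⟨n, by simp⟩
    · exact hNint x hx
    · obtain ⟨z, rfl⟩ := hNint y hy
      exact ⟨-z, by simp⟩
  · intro h3
    -- For `p ≡ 1 (mod 3)` the sum `1 + p + ⋯ + p ^ (m - 1)` is congruent to `m`.
    obtain ⟨t, rfl⟩ : 3 ∣ m := by
      have h : ∑ i ∈ range m, p ^ i ≡ ∑ i ∈ range m, 1 [MOD 3] :=
        Nat.ModEq.sum fun i _ => by simpa using h3.pow i
      rw [hl] at h
      simp only [sum_const, card_range, smul_eq_mul, mul_one] at h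
      unfold Nat.ModEq at h
      omega
    have ht : 0 < t := by omega
    obtain ⟨a, b, f, g, h, hab, hf, hg, hh, heq⟩ :=
      Int.triple_eq_of_split hp h3 ht hsum hsq hprod (hc h3)
    have huniq : ∀ a b a' b' : ℤ, CubicConditions p t a b → CubicConditions p t a' b' →
        a = a' ∧ (b = b' ∨ b = -b') := fun _ _ _ _ => CubicConditions.unique hp hodd ht
    refine ⟨t, rfl, ⟨a, b, hab⟩, huniq, ?_⟩
    have hspec : ∀ (b : ℤ) (g h : ℤ), CubicConditions p t a b →
        2 * (3 * g + 1) = -(a + 9 * b) * (p : ℤ) ^ t →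
        2 * (3 * h + 1) = -(a - 9 * b) * (p : ℤ) ^ t →
        ({e₀, e₁, e₂} : Multiset ℤ) = {f, g, h} →
        (gpSumGraph 3 F).HasSpectrum
          [((n : ℂ), 1),
           (((a : ℂ) * (p : ℂ) ^ t - 1) / 3, n / 2),
           (-(((a : ℂ) * (p : ℂ) ^ t - 1) / 3), n / 2),
           ((-(1 / 2) * ((a : ℂ) + 9 * (b : ℂ)) * (p : ℂ) ^ t - 1) / 3, n / 2),
           (-((-(1 / 2) * ((a : ℂ) + 9 * (b : ℂ)) * (p : ℂ) ^ t - 1) / 3), n / 2),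
           ((-(1 / 2) * ((a : ℂ) - 9 * (b : ℂ)) * (p : ℂ) ^ t - 1) / 3, n / 2),
           (-((-(1 / 2) * ((a : ℂ) - 9 * (b : ℂ)) * (p : ℂ) ^ t - 1) / 3), n / 2)] := by
      intro b g h hab hg hh heq
      have hnodup := hab.nodup hp hodd h3 ht (n := n) (by exact_mod_cast hqn.symm) hf hg hh
      have hf' : ((a : ℂ) * (p : ℂ) ^ t - 1) / 3 = f := by
        have : 3 * (f : ℂ) + 1 = a * (p : ℂ) ^ t := by exact_mod_cast hf
        rw [← this]
        ring
      have hg' : (-(1 / 2) * ((a : ℂ) + 9 * (b : ℂ)) * (p : ℂ) ^ t - 1) / 3 = g := by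
        have : 2 * (3 * (g : ℂ) + 1) = -(a + 9 * b) * (p : ℂ) ^ t := by exact_mod_cast hg
        linear_combination -this / 6
      have hh' : (-(1 / 2) * ((a : ℂ) - 9 * (b : ℂ)) * (p : ℂ) ^ t - 1) / 3 = h := by
        have : 2 * (3 * (h : ℂ) + 1) = -(a - 9 * b) * (p : ℂ) ^ t := by exact_mod_cast hh
        linear_combination -this / 6
      rw [hf', hg', hh', hn2]
      refine Digraph.HasSpectrum.of_eigenvalues_eq_three hΓs ?_ hkpos hnodup
      rw [hN, heq]
      simp only [Multiset.insert_eq_cons, Multiset.map_add, Multiset.map_singleton,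
        ← Multiset.singleton_add, nsmul_add, add_assoc]
    intro a' b' hab'
    obtain ⟨rfl, rfl | rfl⟩ := huniq a b a' b' hab hab'
    · exact hspec b g h hab hg hh heq
    -- Replacing `b` by `-b` exchanges `g` and `h`.
    · refine hspec b' h g hab' (by linear_combination hh) (by linear_combination hg) ?_
      rw [heq]
      exact congrArg (f ::ₘ ·) (Multiset.pair_comm g h)
  · intro h3
    have hpmod : p % 3 = 2 := h3
    -- For odd `m`, `q ≡ 2 ^ m ≡ 2 (mod 3)`, against `q = 3n + 1`.
    obtain ⟨t, rfl⟩ : 2 ∣ m := by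
      rw [← even_iff_two_dvd]
      by_contra hodd'
      obtain ⟨i, rfl⟩ := Nat.not_even_iff_odd.mp hodd'
      have h := h3.pow (2 * i + 1)
      have h4 : 2 ^ (2 * i + 1) ≡ 1 * 2 [MOD 3] := by
        rw [pow_succ, pow_mul]
        exact Nat.ModEq.mul_right 2 (by simpa using (show 2 ^ 2 ≡ 1 [MOD 3] by decide).pow i)
      have h5 := h.trans h4
      rw [hqn] at h5
      unfold Nat.ModEq at h5
      omega
    have ht : 0 < t := by omega
    refine ⟨t, rfl, ?_, ?_⟩
    all_goals
      intro hm4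
      have hs5 : 5 ≤ (p : ℤ) ^ t := by
        have h5 : p ^ 1 ≤ p ^ t := Nat.pow_le_pow_right hp.pos ht
        have : 5 ≤ p := by omega
        rw [pow_one] at h5
        exact_mod_cast (by omega : 5 ≤ p ^ t)
      have hns : 3 * (n : ℤ) + 1 = (p : ℤ) ^ t * (p : ℤ) ^ t := by
        rw [← pow_add, ← two_mul]
        exact_mod_cast hqn.symm
      have hss : 5 * (p : ℤ) ^ t ≤ (p : ℤ) ^ t * (p : ℤ) ^ t :=
        mul_le_mul_of_nonneg_right hs5 (by linarith)
      -- Thus `p ^ t ≡ (-1) ^ t`, and the parity of `t`, that is `m` modulo 4, decides the sign of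
      -- `σ`.
      have hpZ : (p : ℤ) ≡ -1 [ZMOD 3] := by
        unfold Int.ModEq
        omega
      have hpow := hpZ.pow t
    · have hs3 : (p : ℤ) ^ t ≡ 1 [ZMOD 3] := by
        have : Even t := by
          unfold Nat.ModEq at hm4
          exact ⟨t / 2, by omega⟩
        rwa [this.neg_one_pow] at hpow
      obtain ⟨f, g, hf, hg, heq⟩ :=
        Int.triple_eq_of_inert hp h3 (Or.inl rfl) hs3 hsum hsq
      have hf' : ((p : ℂ) ^ t - 1) / 3 = f := by
        have : 3 * (f : ℂ) + 1 = (p : ℂ) ^ t := by exact_mod_cast hf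
        rw [← this]
        ring
      have hg' : (-2 * (p : ℂ) ^ t - 1) / 3 = g := by
        have : 3 * (g : ℂ) + 1 = -2 * (p : ℂ) ^ t := by exact_mod_cast hg
        rw [← this]
        ring
      rw [hf', hg', hn2]
      refine Digraph.HasSpectrum.of_eigenvalues_eq_two hΓs ?_ (by omega) hkpos ?_
      · rw [hN, heq, hk]
        simp only [Multiset.insert_eq_cons, Multiset.map_add, Multiset.map_singleton,
          ← Multiset.singleton_add, nsmul_add, add_nsmul, add_assoc]
      -- With `s² ` abstracted to `r`, the bounds `s ≥ 5` and `r ≥ 5s` make distinctness a linear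
      -- problem.
      · generalize (p : ℤ) ^ t * (p : ℤ) ^ t = r at *
        generalize (p : ℤ) ^ t = s at *
        simp only [List.nodup_cons, List.mem_cons, List.not_mem_nil, not_or, or_false,
          not_false_eq_true, List.nodup_nil, and_true]
        omega
    · have hs3 : -(p : ℤ) ^ t ≡ 1 [ZMOD 3] := by
        have : Odd t := by
          unfold Nat.ModEq at hm4
          exact ⟨t / 2, by omega⟩
        rw [this.neg_one_pow] at hpow
        simpa using hpow.neg
      obtain ⟨f, g, hf, hg, heq⟩ :=
        Int.triple_eq_of_inert hp h3 (Or.inr rfl) hs3 hsum hsq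
      have hf' : (-(p : ℂ) ^ t - 1) / 3 = f := by
        have : 3 * (f : ℂ) + 1 = -(p : ℂ) ^ t := by exact_mod_cast hf
        rw [← this]
        ring
      have hg' : (2 * (p : ℂ) ^ t - 1) / 3 = g := by
        have : 3 * (g : ℂ) + 1 = -2 * -(p : ℂ) ^ t := by exact_mod_cast hg
        linear_combination -this / 3
      rw [hf', hg', hn2]
      refine Digraph.HasSpectrum.of_eigenvalues_eq_two hΓs ?_ hkpos (by omega) ?_
      · rw [hN, heq, hk]
        simp only [Multiset.insert_eq_cons, Multiset.map_add, Multiset.map_singleton,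
          ← Multiset.singleton_add, nsmul_add, add_nsmul]
        abel
      · generalize (p : ℤ) ^ t * (p : ℤ) ^ t = r at *
        generalize (p : ℤ) ^ t = s at *
        simp only [List.nodup_cons, List.mem_cons, List.not_mem_nil, not_or, or_false,
          not_false_eq_true, List.nodup_nil, and_true]
        omega
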